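/- \textbf{Conventions.} A \emph{locally convex algebra} is a complex associative (not necessarily unital) algebra with a complete locally convex vector space topology for which the multiplication is jointly continuous. For a complex Hilbert space $H$ and $1\le q<\infty$, $\mathcal L^q=\mathcal L^q(H)$ is the Schatten class of the bounded operators $T$ with $\|T\|_q=\big(\sum_{n\ge 0} s_n(T)^q\big)^{1/q}<\infty$, where $s_n(T)$ are the singular numbers of $T$; it carries the topology of $\|\cdot\|_q$. For a selfadjoint operator $D$ and a bounded operator $T$, the commutator $[D,T]$ is called bounded if $T$ preserves the domain of $D$ and $DT-TD$ extends to a bounded operator on $H$, again denoted $[D,T]$. Let $A$ be a locally convex algebra with an involution. A \emph{continuous $p$-summable spectral triple} $(H,\varphi,D)$ over $A$ ($1\le p<\infty$) consists of a complex Hilbert space $H$, a norm-continuous $*$-representation $\varphi:A\to\mathbb B(H)$ and a selfadjoint (possibly unbounded) operator $D$ on $H$ such that $[D,\varphi(a)]$ is bounded for all $a\in A$ and $a\mapsto[D,\varphi(a)]$ is continuous into $\mathbb B(H)$, and such that $\varphi(a)(1+D^2)^{-1/2}$ and $(1+D^2)^{-1/2}\varphi(a)$ lie in $\mathcal L^p(H)$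 and are continuous functions of $a\in A$ with values in $\mathcal L^p(H)$. It is \emph{even}, with grading operator $\varepsilon\in\mathbb B(H)$, if $\varepsilon=\varepsilon^*$, $\varepsilon^2=1$, $\varepsilon$ commutes with all $\varphi(a)$, and $\varepsilon$ preserves the domain of $D$ with $D\varepsilon=-\varepsilon D$ there. For locally convex algebras $A$ and $B$, an \emph{$\mathrm{LC}$-Kasparov $(A,B)$-module} $(\hat B,\varphi,F)$ with grading $\varepsilon$ is given by a unital algebra $\hat B$ containing $B$ as a subalgebra, an algebra homomorphism $\varphi:A\to\hat B$ and elements $\varepsilon,F\in\hat B$ such that $\varepsilon^2=1$, $F\varepsilon=-\varepsilon F$, $[\varphi(a),\varepsilon]=0$ for all $a\in A$, and such that the maps \begin{itemize} \item $B\to\hat B$, $b\mapsto bF,\ Fb,\ \varepsilon b,\ b\varepsilon$, \item $A\times B\to\hat B$, $(a,b)\mapsto\varphi(a)b,\ b\varphi(a)$, \item $A\to\hat B$, $a\mapsto\varphi(a)(1-F^2),\ (1-F^2)\varphi(a)$, \item $A\to\hat B$, $a\mapsto[\varphi(a),F]$ \end{itemize} are all $B$-valued and (jointly) continuous for the topologies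 of $A$ and $B$. \textbf{Proposition.} Let $1\le p<\infty$ and let $(H,\varphi,D)$ be an even continuous $p$-summable spectral triple, with grading operator $\varepsilon$, over a locally convex algebra $A$ (with involution) whose multiplication $A\times A\to A$ is surjective and open. Then $\mathcal L^{2p}(H)$ is a locally convex algebra and, with $q(x)=x/\sqrt{1+x^2}$ and thus $q(D)=D(1+D^2)^{-1/2}\in\mathbb B(H)$, the triple $(\mathbb B(H),\varphi,q(D))$ with grading $\varepsilon$ is an $\mathrm{LC}$-Kasparov $(A,\mathcal L^{2p}(H))$-module. -/

import Mathlib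

open scoped InnerProductSpace Topology

namespace LCKasparov

section Schatten

variable {H : Type*} [NormedAddCommGroup H] [InnerProductSpace ℂ H]

/-- The `n`-th singular number of `T` (counted from `n = 0`): the distance in operator norm from `T`
to the operators of rank at most `n`. For compact `T` this is the `n`-th eigenvalue of `|T|` in
decreasing order, with multiplicity. -/
noncomputable def singularNumber (T : H →L[ℂ] H) (n : ℕ) : ℝ :=
  ⨅ S : {S : H →L[ℂ] H // (S : H →ₗ[ℂ] H).rank ≤ n}, ‖T - S‖

/-- The Schatten norm `‖T‖_q = (∑ₙ sₙ(T)^q)^(1/q)`, used only for `T` with `MemSchatten q T`. -/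
noncomputable def schattenNorm (q : ℝ) (T : H →L[ℂ] H) : ℝ :=
  (∑' n, singularNumber T n ^ q) ^ (1 / q)

/-- `T` belongs to the Schatten class `L^q`: its singular numbers are `q`-summable. -/
def MemSchatten (q : ℝ) (T : H →L[ℂ] H) : Prop :=
  Summable fun n => singularNumber T n ^ q

theorem singularNumber_nonneg (T : H →L[ℂ] H) (n : ℕ) : 0 ≤ singularNumber T n :=
  Real.iInf_nonneg fun _ => norm_nonneg _

theorem singularNumber_le (T S : H →L[ℂ] H) {n : ℕ} (hS : (S : H →ₗ[ℂ] H).rank ≤ n) :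
    singularNumber T n ≤ ‖T - S‖ :=
  ciInf_le (f := fun S : {S : H →L[ℂ] H // (S : H →ₗ[ℂ] H).rank ≤ n} => ‖T - S‖)
    ⟨0, by rintro _ ⟨S, rfl⟩; exact norm_nonneg _⟩ ⟨S, hS⟩

instance (n : ℕ) : Nonempty {S : H →L[ℂ] H // (S : H →ₗ[ℂ] H).rank ≤ n} :=
  ⟨⟨0, by rw [ContinuousLinearMap.toLinearMap_zero, LinearMap.rank_zero]; exact zero_le⟩⟩

theorem exists_lt_of_singularNumber_lt {T : H →L[ℂ] H} {n : ℕ} {r : ℝ}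
    (h : singularNumber T n < r) :
    ∃ S : H →L[ℂ] H, (S : H →ₗ[ℂ] H).rank ≤ n ∧ ‖T - S‖ < r := by
  obtain ⟨S, hS⟩ := exists_lt_of_ciInf_lt h
  exact ⟨S, S.2, hS⟩

theorem singularNumber_zero (n : ℕ) : singularNumber (0 : H →L[ℂ] H) n = 0 := by
  refine le_antisymm ?_ (singularNumber_nonneg _ _)
  refine (singularNumber_le 0 0 ?_).trans_eq (by simp)
  rw [ContinuousLinearMap.toLinearMap_zero, LinearMap.rank_zero]; exact zero_le

theorem singularNumber_add_le (S T : H →L[ℂ] H) {m n k : ℕ} (hk : m + n ≤ k) :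
    singularNumber (S + T) k ≤ singularNumber S m + singularNumber T n := by
  refine le_of_forall_pos_le_add fun δ hδ => ?_
  obtain ⟨A, hA, hA'⟩ := exists_lt_of_singularNumber_lt
    (show singularNumber S m < singularNumber S m + δ / 2 by linarith)
  obtain ⟨B, hB, hB'⟩ := exists_lt_of_singularNumber_lt
    (show singularNumber T n < singularNumber T n + δ / 2 by linarith)
  have hr : ((A + B : H →L[ℂ] H) : H →ₗ[ℂ] H).rank ≤ k := by
    rw [ContinuousLinearMap.toLinearMap_add]
    refine (LinearMap.rank_add_le _ _).trans ((add_le_add hA hB).trans ?_)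
    exact_mod_cast hk
  refine (singularNumber_le _ _ hr).trans ?_
  rw [add_sub_add_comm]
  linarith [norm_add_le (S - A) (T - B)]

theorem singularNumber_mul_le_left (S T : H →L[ℂ] H) (n : ℕ) :
    singularNumber (S * T) n ≤ ‖S‖ * singularNumber T n := by
  rw [singularNumber, singularNumber, Real.mul_iInf_of_nonneg (norm_nonneg _)]
  refine le_ciInf fun A => ?_
  refine (singularNumber_le (S * T) (S * A) ?_).trans ?_
  · exact (LinearMap.rank_comp_le_right _ _).trans A.2
  · rw [← mul_sub]; exact norm_mul_le _ _

theorem singularNumber_mul_le_right (S T : H →L[ℂ] H) (n : ℕ) :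
    singularNumber (S * T) n ≤ singularNumber S n * ‖T‖ := by
  rw [singularNumber, singularNumber, Real.iInf_mul_of_nonneg (norm_nonneg _)]
  refine le_ciInf fun A => ?_
  refine (singularNumber_le (S * T) (A * T) ?_).trans ?_
  · exact (LinearMap.rank_comp_le_left _ _).trans A.2
  · rw [← sub_mul]; exact norm_mul_le _ _

theorem singularNumber_smul_le (c : ℂ) (T : H →L[ℂ] H) (n : ℕ) :
    singularNumber (c • T) n ≤ ‖c‖ * singularNumber T n := by
  have h := singularNumber_mul_le_left (c • (1 : H →L[ℂ] H)) T n
  rw [smul_mul_assoc, one_mul] at h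
  refine h.trans (mul_le_mul_of_nonneg_right ?_ (singularNumber_nonneg _ _))
  refine (norm_smul c (1 : H →L[ℂ] H)).le.trans ?_
  exact mul_le_of_le_one_right (norm_nonneg _) ContinuousLinearMap.norm_id_le

theorem rpow_add_le {q : ℝ} (hq : 1 ≤ q) {x y : ℝ} (hx : 0 ≤ x) (hy : 0 ≤ y) :
    (x + y) ^ q ≤ 2 ^ q * (x ^ q + y ^ q) := by
  have hq0 : 0 ≤ q := by linarith
  have h1 : (x + y) ^ q ≤ (2 * max x y) ^ q :=
    Real.rpow_le_rpow (by positivity) (by linarith [le_max_left x y, le_max_right x y]) hq0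
  rw [Real.mul_rpow (by norm_num) (by positivity)] at h1
  refine h1.trans (mul_le_mul_of_nonneg_left ?_ (by positivity))
  have := Real.rpow_nonneg hx q
  have := Real.rpow_nonneg hy q
  rcases max_choice x y with h | h <;> rw [h] <;> linarith

theorem summable_of_doubling {a b : ℕ → ℝ} {B : ℝ} (hb : HasSum b B) (h0 : ∀ k, 0 ≤ a k)
    (hab : ∀ n k, 2 * n ≤ k → a k ≤ b n) : Summable a ∧ ∑' n, a n ≤ 2 * B := by
  have he : Summable fun n => a (2 * n) :=
    Summable.of_nonneg_of_le (fun n => h0 _) (fun n => hab n _ le_rfl) hb.summable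
  have ho : Summable fun n => a (2 * n + 1) :=
    Summable.of_nonneg_of_le (fun n => h0 _) (fun n => hab n _ (by lia)) hb.summable
  have hs := HasSum.even_add_odd he.hasSum ho.hasSum
  refine ⟨hs.summable, ?_⟩
  rw [hs.tsum_eq, two_mul, ← hb.tsum_eq]
  exact add_le_add (he.tsum_le_tsum (fun n => hab n _ le_rfl) hb.summable)
    (ho.tsum_le_tsum (fun n => hab n _ (by lia)) hb.summable)

theorem schatten_add {q : ℝ} (hq : 1 ≤ q) {S T : H →L[ℂ] H}
    (hS : MemSchatten q S) (hT : MemSchatten q T) :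
    MemSchatten q (S + T) ∧ ∑' n, singularNumber (S + T) n ^ q ≤
      2 * (2 ^ q * (∑' n, singularNumber S n ^ q + ∑' n, singularNumber T n ^ q)) := by
  refine summable_of_doubling ((Summable.hasSum hS |>.add (Summable.hasSum hT)).mul_left (2 ^ q))
    (fun k => Real.rpow_nonneg (singularNumber_nonneg _ _) _) (fun n k hk => ?_)
  exact (Real.rpow_le_rpow (singularNumber_nonneg _ _)
    (singularNumber_add_le S T (m := n) (n := n) (by lia)) (by linarith)).trans
    (rpow_add_le hq (singularNumber_nonneg _ _) (singularNumber_nonneg _ _))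

theorem schatten_of_le {q : ℝ} (hq : 1 ≤ q) {S T : H →L[ℂ] H} {c : ℝ} (hc : 0 ≤ c)
    (hT : MemSchatten q T) (h : ∀ n, singularNumber S n ≤ c * singularNumber T n) :
    MemSchatten q S := by
  refine Summable.of_nonneg_of_le (fun n => Real.rpow_nonneg (singularNumber_nonneg _ _) _)
    (fun n => ?_) (hT.mul_left (c ^ q))
  rw [← Real.mul_rpow hc (singularNumber_nonneg _ _)]
  exact Real.rpow_le_rpow (singularNumber_nonneg _ _) (h n) (by linarith)

theorem memSchatten_zero {q : ℝ} (hq : 1 ≤ q) : MemSchatten q (0 : H →L[ℂ] H) := by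
  have : (q : ℝ) ≠ 0 := by linarith
  simp [MemSchatten, singularNumber_zero, Real.zero_rpow this, summable_zero]

variable (H) in
/-- The Schatten class `L^q(H)` as a subalgebra of the bounded operators. -/
def schattenSubalgebra (q : ℝ) (hq : 1 ≤ q) : NonUnitalSubalgebra ℂ (H →L[ℂ] H) where
  carrier := {T | MemSchatten q T}
  add_mem' hS hT := (schatten_add hq hS hT).1
  zero_mem' := memSchatten_zero hq
  mul_mem' {S T} _ hT :=
    schatten_of_le hq (norm_nonneg S) hT (singularNumber_mul_le_left S T)
  smul_mem' c T hT :=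
    schatten_of_le hq (norm_nonneg c) hT (singularNumber_smul_le c T)

variable (H) in
/-- The Schatten class `L^q(H)`, `1 ≤ q < ∞`, as a type of its own: it carries the topology of the
Schatten norm and not the one induced by the operator norm. -/
def SchattenClass (q : ℝ) (hq : 1 ≤ q) : Type _ := schattenSubalgebra H q hq

namespace SchattenClass

variable {q : ℝ} {hq : 1 ≤ q}

instance : NonUnitalRing (SchattenClass H q hq) :=
  inferInstanceAs (NonUnitalRing (schattenSubalgebra H q hq))

instance : Module ℂ (SchattenClass H q hq) :=
  inferInstanceAs (Module ℂ (schattenSubalgebra H q hq))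

instance : IsScalarTower ℂ (SchattenClass H q hq) (SchattenClass H q hq) :=
  inferInstanceAs (IsScalarTower ℂ (schattenSubalgebra H q hq) (schattenSubalgebra H q hq))

instance : SMulCommClass ℂ (SchattenClass H q hq) (SchattenClass H q hq) :=
  inferInstanceAs (SMulCommClass ℂ (schattenSubalgebra H q hq) (schattenSubalgebra H q hq))

variable (H q hq) in
/-- The inclusion of `L^q(H)` into the bounded operators. -/
def incl : SchattenClass H q hq →ₙₐ[ℂ] (H →L[ℂ] H) :=
  NonUnitalSubalgebraClass.subtype (schattenSubalgebra H q hq)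

variable (H q hq) in
/-- The open ball of radius `r` about `0` for the Schatten norm. -/
def ball (r : ℝ) : Set (SchattenClass H q hq) := {T | schattenNorm q (incl H q hq T) < r}

theorem mem_ball_iff {r : ℝ} (hr : 0 < r) (T : SchattenClass H q hq) :
    T ∈ ball H q hq r ↔ ∑' n, singularNumber (incl H q hq T) n ^ q < r ^ q := by
  have hq0 : 0 < q := by linarith
  have h0 : 0 ≤ ∑' n, singularNumber (incl H q hq T) n ^ q :=
    tsum_nonneg fun n => Real.rpow_nonneg (singularNumber_nonneg _ _) _
  change (_ : ℝ) ^ (1 / q) < r ↔ _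
  rw [one_div, Real.rpow_inv_lt_iff_of_pos h0 hr.le hq0]

variable (H q hq) in
/-- The balls of the Schatten norm, as a basis of neighbourhoods of `0`. -/
@[reducible] def filterBasis : AddGroupFilterBasis (SchattenClass H q hq) :=
  addGroupFilterBasisOfComm {U | ∃ r > 0, U = ball H q hq r} ⟨_, 1, one_pos, rfl⟩
    (by
      rintro _ _ ⟨r, hr, rfl⟩ ⟨s, hs, rfl⟩
      exact ⟨_, ⟨min r s, lt_min hr hs, rfl⟩, fun T (hT : schattenNorm q _ < _) =>
        ⟨hT.trans_le (min_le_left _ _), hT.trans_le (min_le_right _ _)⟩⟩)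
    (by
      rintro _ ⟨r, hr, rfl⟩
      have : (q : ℝ) ≠ 0 := by linarith
      rw [mem_ball_iff hr, map_zero]
      simpa [singularNumber_zero, Real.zero_rpow this] using Real.rpow_pos_of_pos hr q)
    (by
      rintro _ ⟨r, hr, rfl⟩
      have hq0 : 0 < q := by linarith
      refine ⟨_, ⟨r / 8, by positivity, rfl⟩, ?_⟩
      rintro _ ⟨S, hS, T, hT, rfl⟩
      rw [mem_ball_iff (by positivity)] at hS hT
      rw [mem_ball_iff hr]
      simp only [map_add]
      refine (schatten_add hq S.2 T.2).2.trans_lt ?_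
      have h2 : (0 : ℝ) < 2 ^ q := by positivity
      have h4 : (4 : ℝ) ≤ 4 ^ q := Real.self_le_rpow_of_one_le (by norm_num) hq
      have h8 : r ^ q = 2 ^ q * (4 ^ q * (r / 8) ^ q) := by
        rw [← Real.mul_rpow (by norm_num) (by positivity),
          ← Real.mul_rpow (by norm_num) (by positivity)]
        congr 1; ring
      have h9 : 0 < (r / 8) ^ q := by positivity
      rw [h8]
      change ∑' n, singularNumber (incl H q hq S) n ^ q < _ at hS
      change ∑' n, singularNumber (incl H q hq T) n ^ q < _ at hT
      change 2 * (2 ^ q * (∑' n, singularNumber (incl H q hq S) n ^ q +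
        ∑' n, singularNumber (incl H q hq T) n ^ q)) < _
      have : 4 * (r / 8) ^ q ≤ 4 ^ q * (r / 8) ^ q := by gcongr
      nlinarith)
    (by
      rintro _ ⟨r, hr, rfl⟩
      refine ⟨_, ⟨r, hr, rfl⟩, fun T hT => ?_⟩
      rw [mem_ball_iff hr] at hT
      change -T ∈ ball H q hq r
      rw [mem_ball_iff hr, map_neg]
      refine lt_of_le_of_lt ?_ hT
      have hle : ∀ n, singularNumber (-incl H q hq T) n ≤ singularNumber (incl H q hq T) n :=
        fun n => by simpa using singularNumber_smul_le (-1) (incl H q hq T) n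
      have hle' : ∀ n, singularNumber (-incl H q hq T) n ^ q ≤
          singularNumber (incl H q hq T) n ^ q := fun n =>
        Real.rpow_le_rpow (singularNumber_nonneg _ _) (hle n) (by linarith)
      exact (Summable.of_nonneg_of_le (fun n => Real.rpow_nonneg (singularNumber_nonneg _ _) _)
        hle' T.2).tsum_le_tsum hle' T.2)

/-- The translation-invariant uniformity (and the topology) given by the Schatten norm. -/
noncomputable instance : UniformSpace (SchattenClass H q hq) :=
  @IsTopologicalAddGroup.rightUniformSpace _ _ (filterBasis H q hq).topology
    (filterBasis H q hq).isTopologicalAddGroup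

theorem nhds_zero_hasBasis :
    (𝓝 (0 : SchattenClass H q hq)).HasBasis (fun r : ℝ => 0 < r) (ball H q hq) := by
  have h := @AddGroupFilterBasis.nhds_zero_hasBasis _ _ (filterBasis H q hq)
  refine ⟨fun U => (h.mem_iff (t := U)).trans ⟨?_, ?_⟩⟩
  · rintro ⟨_, ⟨r, hr, rfl⟩, hU⟩
    exact ⟨r, hr, hU⟩
  · rintro ⟨r, hr, hU⟩
    exact ⟨_, ⟨r, hr, rfl⟩, hU⟩

end SchattenClass

end Schatten

section Unbounded

variable {H : Type*} [NormedAddCommGroup H] [InnerProductSpace ℂ H]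

/-- `S` is the bounded operator `(1 + D²)⁻¹`: for every `x`, the vector `y = S x` lies in the domain
of `D²` and `y + D (D y) = x`. -/
def IsOneAddSqInv (D : H →ₗ.[ℂ] H) (S : H →L[ℂ] H) : Prop :=
  ∀ x : H, ∃ y z : D.domain, (y : H) = S x ∧ (z : H) = D y ∧ (y : H) + D z = x

open Classical in
/-- The operator `(1 + D²)⁻¹`; it exists and is unique for self-adjoint `D`, see `oneAddSqInv_spec`
and `oneAddSqInv_apply_eq`. -/
noncomputable def oneAddSqInv (D : H →ₗ.[ℂ] H) : H →L[ℂ] H :=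
  if h : ∃ S : H →L[ℂ] H, IsOneAddSqInv D S then h.choose else 0

/-- The operator `(1 + D²)^(-1/2)`, the positive square root of `(1 + D²)⁻¹`. -/
noncomputable def oneAddSqInvSqrt [CompleteSpace H] (D : H →ₗ.[ℂ] H) : H →L[ℂ] H :=
  CFC.sqrt (oneAddSqInv D)

/-- `F` is the everywhere defined bounded operator `D (1 + D²)^(-1/2)`. -/
def IsBoundedTransform [CompleteSpace H] (D : H →ₗ.[ℂ] H) (F : H →L[ℂ] H) : Prop :=
  ∀ x : H, ∃ y : D.domain, (y : H) = oneAddSqInvSqrt D x ∧ F x = D y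

open Classical in
/-- The bounded transform `q(D) = D (1 + D²)^(-1/2)` with `q(x) = x / √(1 + x²)`; it exists for
self-adjoint `D`, see `boundedTransform_spec`. -/
noncomputable def boundedTransform [CompleteSpace H] (D : H →ₗ.[ℂ] H) : H →L[ℂ] H :=
  if h : ∃ F : H →L[ℂ] H, IsBoundedTransform D F then h.choose else 0

variable [CompleteSpace H] {D : H →ₗ.[ℂ] H}

theorem inner_apply_symm (hD : IsSelfAdjoint D) (x y : D.domain) :
    ⟪D x, (y : H)⟫_ℂ = ⟪(x : H), D y⟫_ℂ := by
  have h : D.IsFormalAdjoint D := by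
    have := LinearPMap.adjoint_isFormalAdjoint hD.dense_domain
    rwa [LinearPMap.isSelfAdjoint_def.mp hD] at this
  exact h x y

theorem exists_domain_of_inner (hD : IsSelfAdjoint D) {y w : H}
    (h : ∀ x : D.domain, ⟪w, (x : H)⟫_ℂ = ⟪y, D x⟫_ℂ) : ∃ u : D.domain, (u : H) = y ∧ D u = w := by
  have h' : ∃ u : D.adjoint.domain, (u : H) = y ∧ D.adjoint u = w :=
    ⟨⟨y, LinearPMap.mem_adjoint_domain_of_exists y ⟨w, h⟩⟩, rfl,
      LinearPMap.adjoint_apply_eq hD.dense_domain _ h⟩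
  rwa [LinearPMap.isSelfAdjoint_def.mp hD] at h'

/-- For self-adjoint `D` the operator `(1 + D²)⁻¹` exists. -/
theorem exists_isOneAddSqInv (hD : IsSelfAdjoint D) : ∃ S : H →L[ℂ] H, IsOneAddSqInv D S := by
  let e := WithLp.prodContinuousLinearEquiv 2 ℂ H H
  let G : Submodule ℂ (WithLp 2 (H × H)) := D.graph.comap e.toLinearMap
  have hG : IsClosed (G : Set (WithLp 2 (H × H))) := by
    have h1 : IsClosed (D.graph : Set (H × H)) := hD.isClosed
    exact h1.preimage e.continuous
  have : CompleteSpace G := hG.completeSpace_coe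
  let P := G.starProjection
  let S : H →L[ℂ] H := (ContinuousLinearMap.fst ℂ H H).comp
    (e.toContinuousLinearMap.comp (P.comp (e.symm.toContinuousLinearMap.comp
      (ContinuousLinearMap.inl ℂ H H))))
  refine ⟨S, fun x => ?_⟩
  let v := P (e.symm (x, 0))
  have hv : v ∈ G := G.starProjection_apply_mem _
  have hvg : e v ∈ D.graph := hv
  obtain ⟨u, hu1, hu2⟩ := (LinearPMap.mem_graph_iff D).1 hvg
  have horth : ∀ z : D.domain, ⟪x - u, (z : H)⟫_ℂ = ⟪D u, D z⟫_ℂ := by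
    intro z
    have hz : e.symm ((z : H), D z) ∈ G := by
      change e (e.symm _) ∈ D.graph
      rw [e.apply_symm_apply]; exact D.mem_graph z
    have := G.starProjection_inner_eq_zero (e.symm (x, 0)) _ hz
    have hve : v = e.symm ((u : H), D u) := by
      rw [ContinuousLinearEquiv.eq_symm_apply]
      exact Prod.ext hu1.symm hu2.symm
    change ⟪e.symm (x, 0) - v, _⟫_ℂ = 0 at this
    rw [hve, ← map_sub, WithLp.prod_inner_apply] at this
    simp only [Prod.mk_sub_mk, zero_sub] at this
    change ⟪x - u, (z : H)⟫_ℂ + ⟪-D u, D z⟫_ℂ = 0 at this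
    rw [inner_neg_left] at this
    linear_combination this
  obtain ⟨z, h2, h3⟩ := exists_domain_of_inner hD horth
  exact ⟨u, z, hu1, h2, by rw [h3]; abel⟩

theorem oneAddSqInv_spec (hD : IsSelfAdjoint D) : IsOneAddSqInv D (oneAddSqInv D) := by
  rw [oneAddSqInv, dif_pos (exists_isOneAddSqInv hD)]
  exact (exists_isOneAddSqInv hD).choose_spec

theorem oneAddSqInv_apply_eq (hD : IsSelfAdjoint D) {x : H} (b d : D.domain) (hd : (d : H) = D b)
    (h : (b : H) + D d = x) : oneAddSqInv D x = b := by
  obtain ⟨a, c, ha, hc, hx⟩ := oneAddSqInv_spec hD x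
  have e1 : ((a - b : D.domain) : H) + D (c - d) = 0 := by
    rw [LinearPMap.map_sub, Submodule.coe_sub, sub_add_sub_comm, hx, h, sub_self]
  have e2 : ((c - d : D.domain) : H) = D (a - b) := by
    rw [LinearPMap.map_sub, Submodule.coe_sub, hc, hd]
  have e3 := inner_apply_symm hD (c - d) (a - b)
  rw [e2, eq_neg_of_add_eq_zero_right e1, inner_neg_left, inner_self_eq_norm_sq_to_K,
    inner_self_eq_norm_sq_to_K] at e3
  have e5 : -‖((a - b : D.domain) : H)‖ ^ 2 = ‖D (a - b)‖ ^ 2 := by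
    have := congrArg Complex.re e3
    norm_cast at this
  have e6 : ‖((a - b : D.domain) : H)‖ = 0 := by
    nlinarith [sq_nonneg ‖D (a - b)‖, sq_nonneg ‖((a - b : D.domain) : H)‖]
  rw [← ha]
  exact sub_eq_zero.1 (norm_eq_zero.1 e6)

theorem oneAddSqInv_nonneg (hD : IsSelfAdjoint D) : 0 ≤ oneAddSqInv D := by
  rw [ContinuousLinearMap.nonneg_iff_isPositive, ContinuousLinearMap.isPositive_iff_complex]
  intro x
  obtain ⟨a, c, ha, hc, hx⟩ := oneAddSqInv_spec hD x
  have : ⟪oneAddSqInv D x, x⟫_ℂ = ((‖(a : H)‖ ^ 2 + ‖(c : H)‖ ^ 2 : ℝ) : ℂ) := by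
    rw [← ha, ← hx, inner_add_right, ← inner_apply_symm hD, ← hc, inner_self_eq_norm_sq_to_K,
      inner_self_eq_norm_sq_to_K]
    push_cast; rfl
  rw [this]
  refine ⟨congrArg Complex.ofReal (Complex.ofReal_re _), ?_⟩
  change 0 ≤ (((‖(a : H)‖ ^ 2 + ‖(c : H)‖ ^ 2 : ℝ) : ℂ)).re
  rw [Complex.ofReal_re]; positivity

/-- For self-adjoint `D` the operator `D (1 + D²)^(-1/2)` is everywhere defined and bounded. -/
theorem exists_isBoundedTransform (hD : IsSelfAdjoint D) :
    ∃ F : H →L[ℂ] H, IsBoundedTransform D F := by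
  set S := oneAddSqInv D with hS
  set R := oneAddSqInvSqrt D with hR
  have hRR : ∀ x, R (R x) = S x := fun x => by
    have : R * R = S := CFC.sqrt_mul_sqrt_self _ (oneAddSqInv_nonneg hD)
    rw [← this]; rfl
  have hRs : ∀ x y, ⟪R x, y⟫_ℂ = ⟪x, R y⟫_ℂ := fun x y => by
    have : 0 ≤ R := CFC.sqrt_nonneg _
    exact ((ContinuousLinearMap.nonneg_iff_isPositive _).1 this).isSymmetric x y
  have key : ∀ z : D.domain, ‖R (D z)‖ ≤ ‖(z : H)‖ := by
    intro z
    obtain ⟨a, c, ha, hc, hx⟩ := oneAddSqInv_spec hD (z : H)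
    let d : D.domain := z - a
    have hd : (d : H) = D c := by
      rw [show (d : H) = z - a from rfl, ← hx]; abel
    have hSD : S (D z) = c := by
      refine oneAddSqInv_apply_eq hD c d hd ?_
      rw [show d = z - a from rfl, LinearPMap.map_sub, hc]; abel
    have h1 : ⟪R (D z), R (D z)⟫_ℂ = ⟪(z : H), z⟫_ℂ - ⟪S z, z⟫_ℂ := by
      rw [← hRs, hRR, hSD, ← inner_apply_symm hD, ← hd, show (d : H) = z - a from rfl,
        inner_sub_left, ha]
    have h2 : ⟪S z, (z : H)⟫_ℂ = ⟪R z, R z⟫_ℂ := by rw [← hRs, hRR]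
    rw [h2] at h1
    simp only [inner_self_eq_norm_sq_to_K] at h1
    have h3 : ‖R (D z)‖ ^ 2 = ‖(z : H)‖ ^ 2 - ‖R z‖ ^ 2 := by exact_mod_cast h1
    exact abs_le_of_sq_le_sq' (by nlinarith [sq_nonneg ‖R z‖]) (norm_nonneg _) |>.2
  have hdom : ∀ x, ∃ y : D.domain, (y : H) = R x := by
    intro x
    have hmem : R x ∈ D.adjoint.domain := by
      rw [LinearPMap.mem_adjoint_domain_iff]
      refine AddMonoidHomClass.continuous_of_bound _ ‖x‖ fun z => ?_
      change ‖⟪R x, D z⟫_ℂ‖ ≤ _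
      rw [hRs]
      exact (norm_inner_le_norm _ _).trans (by gcongr; exact key z)
    rw [LinearPMap.isSelfAdjoint_def.mp hD] at hmem
    exact ⟨⟨_, hmem⟩, rfl⟩
  choose f hf using hdom
  have hfb : ∀ x, ‖D (f x)‖ ≤ ‖x‖ := by
    intro x
    have hz : ∀ z : H, ‖⟪D (f x), z⟫_ℂ‖ ≤ ‖x‖ * ‖z‖ := by
      intro z
      refine hD.dense_domain.induction (P := fun z => ‖⟪D (f x), z⟫_ℂ‖ ≤ ‖x‖ * ‖z‖) ?_ ?_ z
      · intro z hz
        have := inner_apply_symm hD (f x) ⟨z, hz⟩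
        simp only at this
        rw [this, hf, hRs]
        exact (norm_inner_le_norm _ _).trans (by gcongr; exact key ⟨z, hz⟩)
      · exact isClosed_le (by fun_prop) (by fun_prop)
    have := hz (D (f x))
    rw [inner_self_eq_norm_sq_to_K] at this
    have h4 : ‖D (f x)‖ ^ 2 ≤ ‖x‖ * ‖D (f x)‖ := by simpa using this
    by_contra hlt
    push Not at hlt
    nlinarith [norm_nonneg x]
  let L : H →ₗ[ℂ] H :=
    { toFun := fun x => D (f x)
      map_add' := fun x y => by
        rw [← LinearPMap.map_add]; congr 1; apply Subtype.ext; simp [hf]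
      map_smul' := fun c x => by
        rw [RingHom.id_apply, ← LinearPMap.map_smul]; congr 1; apply Subtype.ext; simp [hf] }
  exact ⟨L.mkContinuous 1 fun x => by simpa [L] using hfb x, fun x => ⟨f x, hf x, rfl⟩⟩

theorem boundedTransform_spec (hD : IsSelfAdjoint D) :
    IsBoundedTransform D (boundedTransform D) := by
  rw [boundedTransform, dif_pos (exists_isBoundedTransform hD)]
  exact (exists_isBoundedTransform hD).choose_spec

end Unbounded
section Modules

/-- A locally convex algebra: an associative complex algebra with a complete locally convex vector
space topology for which the multiplication is jointly continuous. -/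
class LocallyConvexAlgebra (A : Type*) [NonUnitalRing A] [Module ℂ A] [UniformSpace A] : Prop
    extends IsUniformAddGroup A, ContinuousSMul ℂ A, ContinuousMul A, IsScalarTower ℂ A A,
      SMulCommClass ℂ A A, CompleteSpace A where
  locallyConvex : LocallyConvexSpace ℝ A

/-- The map `g` takes values in `B` (a subspace of `C` by means of `ι`) and is continuous for the
topology of `B`. -/
def IsContinuousInto {X B C : Type*} [TopologicalSpace X] [TopologicalSpace B] (ι : B → C)
    (g : X → C) : Prop :=
  ∃ h : X → B, Continuous h ∧ ∀ x, ι (h x) = g x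

/-- `(Bhat, φ, F)` is a locally convex Kasparov `(A, B)`-module with grading `ε`, where `ι` is the
inclusion of the algebra `B` into the algebra `Bhat`. -/
structure IsLCKasparovModule {A B Bhat : Type*} [NonUnitalRing A] [Module ℂ A] [UniformSpace A]
    [NonUnitalRing B] [Module ℂ B] [UniformSpace B] [Ring Bhat] [Algebra ℂ Bhat]
    (ι : B →ₙₐ[ℂ] Bhat) (φ : A →ₙₐ[ℂ] Bhat) (ε F : Bhat) : Prop where
  locallyConvexAlgebra_left : LocallyConvexAlgebra A
  locallyConvexAlgebra_right : LocallyConvexAlgebra B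
  injective : Function.Injective ι
  grading_sq : ε * ε = 1
  odd : F * ε = -(ε * F)
  even : ∀ a, φ a * ε = ε * φ a
  mul_F : IsContinuousInto ι fun b : B => ι b * F
  F_mul : IsContinuousInto ι fun b : B => F * ι b
  grading_mul : IsContinuousInto ι fun b : B => ε * ι b
  mul_grading : IsContinuousInto ι fun b : B => ι b * ε
  rep_mul : IsContinuousInto ι fun x : A × B => φ x.1 * ι x.2
  mul_rep : IsContinuousInto ι fun x : A × B => ι x.2 * φ x.1
  rep_mul_one_sub_sq : IsContinuousInto ι fun a : A => φ a * (1 - F * F)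
  one_sub_sq_mul_rep : IsContinuousInto ι fun a : A => (1 - F * F) * φ a
  commutator : IsContinuousInto ι fun a : A => φ a * F - F * φ a

variable {A H : Type*} [NormedAddCommGroup H] [InnerProductSpace ℂ H]

/-- `C` is the bounded operator `[D, T]`: `T` preserves the domain of `D`, and `C` extends
`D T - T D`. -/
def IsCommutator (D : H →ₗ.[ℂ] H) (T C : H →L[ℂ] H) : Prop :=
  ∀ x : D.domain, ∃ y : D.domain, (y : H) = T x ∧ C x = D y - T (D x)

variable [CompleteSpace H] [NonUnitalRing A] [StarRing A] [Module ℂ A]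

/-- `(H, φ, D)` is a spectral triple over the involutive algebra `A`. -/
structure IsSpectralTriple (φ : A →⋆ₙₐ[ℂ] (H →L[ℂ] H)) (D : H →ₗ.[ℂ] H) : Prop where
  selfAdjoint : IsSelfAdjoint D
  commutator : ∀ a, ∃ C : H →L[ℂ] H, IsCommutator D (φ a) C
  compact : ∀ a, IsCompactOperator (φ a * oneAddSqInvSqrt D)

/-- The spectral triple is even for the grading of `H` with grading operator `ε` (`ε = 1` on the
even and `ε = -1` on the odd part): `φ` is even and `D` is odd. -/
structure IsEvenFor (ε : H →L[ℂ] H) (φ : A →⋆ₙₐ[ℂ] (H →L[ℂ] H)) (D : H →ₗ.[ℂ] H) : Prop where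
  selfAdjoint : IsSelfAdjoint ε
  sq : ε * ε = 1
  even : ∀ a, φ a * ε = ε * φ a
  odd : ∀ x : D.domain, ∃ y : D.domain, (y : H) = ε x ∧ D y = -ε (D x)

/-- `(H, φ, D)` is a continuous `p`-summable spectral triple over the (locally convex) algebra `A`;
the representation `φ` is continuous for the operator norm. -/
structure IsContinuousSummableSpectralTriple [UniformSpace A] (p : ℝ) (hp : 1 ≤ p)
    (φ : A →⋆ₙₐ[ℂ] (H →L[ℂ] H)) (D : H →ₗ.[ℂ] H) : Prop extends IsSpectralTriple φ D where
  continuous_rep : Continuous φ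
  continuous_commutator : ∃ δ : A → H →L[ℂ] H, Continuous δ ∧ ∀ a, IsCommutator D (φ a) (δ a)
  summable_right :
    IsContinuousInto (SchattenClass.incl H p hp) fun a => φ a * oneAddSqInvSqrt D
  summable_left :
    IsContinuousInto (SchattenClass.incl H p hp) fun a => oneAddSqInvSqrt D * φ a

end Modules

theorem one_le_two_mul {p : ℝ} (hp : 1 ≤ p) : 1 ≤ 2 * p := by linarith

end LCKasparov

/-!
Write `R = (1 + D²)^(-1/2)` and `F = D R`. Two facts have to be proved: `L^(2p)` is a locally convex
algebra, and the commutators `[φ(a), F]` depend continuously on `a` as elements of `L^(2p)`.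

*Local convexity.* For `q = 2p ≥ 2` the functional `T ↦ ∑ₙ sₙ(T)^q` is convex, being the supremum of
`∑ ‖T eᵢ‖^q` over finite orthonormal families `e`. That it dominates these sums follows from the
finite-dimensional spectral theorem, Jensen's inequality and the min-max principle
(`sum_norm_rpow_le_sum_singularNumber`); a greedy choice of the `eᵢ` shows that it is the supremum
(`exists_orthonormal_sum_singularNumber_le`). So the balls of the Schatten norm are convex.
Completeness is inherited from the bounded operators, as every `sₙ` is continuous in norm.

*Commutators.* Let `T = F (1 + R)⁻¹` and let `K` be the square root of `1 - T² = 2 R (1 + R)⁻¹`. If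
`B = [D, c]` is bounded, then `F c R - R c F = R B R`, and in terms of `Y = [T, c]` this becomes
`Y + T Y T = K² (B / 2) K²`. The solution is `Y = ∑ₙ (-1)ⁿ Tⁿ K² (B / 2) K² Tⁿ`. As `‖Tⁿ K‖` is
`O(n^(-1/2))` and `‖Tⁿ K²‖` is `O(n⁻¹)`, the series still converges absolutely when one of the
four factors `K` is removed. Hence `Y`, and with it `[F, c]`, has the form `K Λ₁(B)` and also
`Λ₂(B) K` with `Λ₁`, `Λ₂` bounded (`exists_commutator_factorization`). The series does the work of
the usual integral representation of `R` by resolvents.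

Now `φ(b) K` lies in `L^(2p)`, because `(φ(b) K) (φ(b) K)*` contains the factor `φ(b) R`, which lies
in `L^p`. Hence `[φ(b c), F] = φ(b) [φ(c), F] + [φ(b), F] φ(c)` is in `L^(2p)`, continuously in
`(b, c)`, and continuity in `b c` follows because the multiplication is open and surjective
(`isContinuousInto_commutator`).
-/

/-! ### Singular numbers and orthonormal families -/

namespace LCKasparov

section SingularNumbers

variable {H : Type*} [NormedAddCommGroup H] [InnerProductSpace ℂ H]

theorem norm_sq_sum_smul_of_pairwise_orthogonal {ι : Type*} [Fintype ι] {w : ι → H}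
    (hw : Pairwise fun i j => ⟪w i, w j⟫_ℂ = 0) (a : ι → ℂ) :
    ‖∑ i, a i • w i‖ ^ 2 = ∑ i, ‖a i‖ ^ 2 * ‖w i‖ ^ 2 := by
  classical
  rw [← Complex.ofReal_inj]
  push_cast
  rw [← Complex.coe_algebraMap, ← inner_self_eq_norm_sq_to_K (𝕜 := ℂ), sum_inner]
  refine Finset.sum_congr rfl fun i _ => ?_
  rw [inner_sum, Finset.sum_eq_single i]
  · rw [inner_smul_left, inner_smul_right, inner_self_eq_norm_sq_to_K, ← mul_assoc,
      Complex.conj_mul']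
    rfl
  · intro j _ hj
    rw [inner_smul_left, inner_smul_right, hw hj.symm, mul_zero, mul_zero]
  · simp

/-- The min-max lower bound: on the span of the `v i` the operator `T` stretches every vector by at
least `c`, and every operator of rank at most `n` has a kernel vector there. -/
theorem le_singularNumber_of_orthonormal {T : H →L[ℂ] H} {n : ℕ} {c : ℝ} (hc : 0 ≤ c)
    {v : Fin (n + 1) → H} (hv : Orthonormal ℂ v)
    (hTv : Pairwise fun i j => ⟪T (v i), T (v j)⟫_ℂ = 0) (h : ∀ i, c ≤ ‖T (v i)‖) :
    c ≤ singularNumber T n := by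
  refine le_ciInf fun ⟨A, hA⟩ => ?_
  have hdep : ¬ LinearIndependent ℂ fun i => A (v i) := by
    intro hli
    have hli' : LinearIndependent ℂ fun i => (A : H →ₗ[ℂ] H).rangeRestrict (v i) := by
      refine LinearIndependent.of_comp (LinearMap.range (A : H →ₗ[ℂ] H)).subtype ?_
      exact hli
    have h1 := hli'.cardinal_lift_le_rank
    simp only [Cardinal.mk_fin, Cardinal.lift_natCast] at h1
    have h3 : ((n + 1 : ℕ) : Cardinal) ≤ n := h1.trans (by simpa [LinearMap.rank] using hA)
    have := Nat.cast_le.1 h3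
    lia
  obtain ⟨a, ha, i, hi⟩ := Fintype.not_linearIndependent_iff.1 hdep
  set x := ∑ i, a i • v i with hx
  have hAx : A x = 0 := by rw [hx, map_sum]; simpa using ha
  have hxn : ‖x‖ ^ 2 = ∑ i, ‖a i‖ ^ 2 := by
    rw [hx, norm_sq_sum_smul_of_pairwise_orthogonal hv.2]
    simp [hv.1]
  have hTx : ‖T x‖ ^ 2 = ∑ i, ‖a i‖ ^ 2 * ‖T (v i)‖ ^ 2 := by
    rw [hx, map_sum]
    simp_rw [map_smul]
    exact norm_sq_sum_smul_of_pairwise_orthogonal hTv a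
  have hpos : 0 < ‖x‖ := by
    have : 0 < ‖x‖ ^ 2 := by
      rw [hxn]
      exact Finset.sum_pos' (fun _ _ => by positivity) ⟨i, Finset.mem_univ _, by positivity⟩
    exact lt_of_le_of_ne (norm_nonneg x) fun h => by simp [← h] at this
  have h1 : c * ‖x‖ ≤ ‖T x‖ := by
    refine le_of_sq_le_sq ?_ (norm_nonneg _)
    rw [mul_pow, hxn, hTx, Finset.mul_sum]
    refine Finset.sum_le_sum fun i _ => ?_
    rw [mul_comm]
    have := h i
    gcongr
  have h2 : ‖T x‖ ≤ ‖T - A‖ * ‖x‖ := by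
    have := (T - A).le_opNorm x
    rwa [sub_apply, hAx, sub_zero] at this
  exact le_of_mul_le_mul_right (h1.trans h2) hpos

theorem norm_le_singularNumber_zero (T : H →L[ℂ] H) : ‖T‖ ≤ singularNumber T 0 := by
  refine le_ciInf fun ⟨A, hA⟩ => ?_
  have : A = 0 := by
    have h0 : (A : H →ₗ[ℂ] H) = 0 :=
      LinearMap.range_eq_bot.1 (Submodule.rank_eq_zero.1 (le_antisymm (by simpa using hA) zero_le))
    ext x
    exact congrArg (fun f : H →ₗ[ℂ] H => f x) h0
  simp [this]

/-- The energy `∑ ‖T eᵢ‖^(2p)` of an orthonormal family is bounded by that of the singular numbers: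
diagonalise the compression of `T* T` to the span of the family; then `‖T eᵢ‖²` is an average of
its eigenvalues, and Jensen's inequality applies. -/
theorem sum_norm_rpow_le_sum_singularNumber [CompleteSpace H] (T : H →L[ℂ] H) {p : ℝ} (hp : 1 ≤ p)
    {m : ℕ} {e : Fin m → H} (he : Orthonormal ℂ e) :
    ∑ i, ‖T (e i)‖ ^ (2 * p) ≤ ∑ j : Fin m, singularNumber T j ^ (2 * p) := by
  have hp0 : 0 ≤ p := by linarith
  let E := Submodule.span ℂ (Set.range e)
  have hn : Module.finrank ℂ E = m := by
    simpa using finrank_span_eq_card he.linearIndependent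
  have : FiniteDimensional ℂ E := FiniteDimensional.span_of_finite ℂ (Set.finite_range e)
  let V : E →L[ℂ] H := T ∘L E.subtypeL
  let S : E →L[ℂ] E := V.adjoint ∘L V
  have hS : (S : E →ₗ[ℂ] E).IsSymmetric :=
    (ContinuousLinearMap.isPositive_adjoint_comp_self V).isSymmetric
  let u := hS.eigenvectorBasis hn
  let μ := hS.eigenvalues hn
  have hin : ∀ x y : E, ⟪S x, y⟫_ℂ = ⟪T x, T y⟫_ℂ := fun x y =>
    ContinuousLinearMap.adjoint_inner_left V y (V x)
  have hSu : ∀ j, S (u j) = (μ j : ℂ) • u j := fun j => hS.apply_eigenvectorBasis hn j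
  have huT : ∀ i j, ⟪T (u i), T (u j)⟫_ℂ = if i = j then (μ i : ℂ) else 0 := by
    intro i j
    rw [← hin, hSu, inner_smul_left, orthonormal_iff_ite.1 u.orthonormal i j]
    simp
  have hμ : ∀ j, μ j = ‖T (u j)‖ ^ 2 := by
    intro j
    have := huT j j
    rw [if_pos rfl, inner_self_eq_norm_sq_to_K] at this
    exact Complex.ofReal_injective (by rw [← this]; push_cast; rfl)
  have hμ0 : ∀ j, 0 ≤ μ j := fun j => by rw [hμ]; positivity
  have hμs : ∀ j : Fin m, μ j ^ p ≤ singularNumber T j ^ (2 * p) := by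
    intro j
    rw [hμ, ← Real.rpow_natCast, ← Real.rpow_mul (norm_nonneg _)]
    refine Real.rpow_le_rpow (norm_nonneg _) ?_ (by positivity)
    let f : Fin (j + 1) → Fin m := Fin.castLE (by lia)
    have hf : Function.Injective f := Fin.castLE_injective _
    refine le_singularNumber_of_orthonormal (norm_nonneg _) (v := fun i => (u (f i) : H))
      ((u.orthonormal.comp f hf).comp_linearIsometry E.subtypeₗᵢ) ?_ ?_
    · intro i k hik
      rw [huT, if_neg (hf.ne hik)]
    · intro i
      refine le_of_sq_le_sq ?_ (norm_nonneg _)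
      rw [← hμ, ← hμ]
      refine hS.eigenvalues_antitone hn ?_
      change (f i : ℕ) ≤ j
      have := i.2
      simp only [f, Fin.val_castLE]
      lia
  let e' : Fin m → E := fun i => ⟨e i, Submodule.subset_span ⟨i, rfl⟩⟩
  have he' : Orthonormal ℂ e' := by
    rw [← LinearIsometry.orthonormal_comp_iff E.subtypeₗᵢ]
    exact he
  have hT : ∀ i, ‖T (e i)‖ ^ 2 = ∑ j, ‖⟪u j, e' i⟫_ℂ‖ ^ 2 * μ j := by
    intro i
    have h1 : T (e i) = ∑ j, ⟪u j, e' i⟫_ℂ • T (u j) := by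
      have := congrArg (fun x : E => T x) (u.sum_repr' (e' i))
      simp only [AddSubmonoidClass.coe_finsetSum, map_sum, Submodule.coe_smul, map_smul] at this
      exact this.symm
    rw [h1, norm_sq_sum_smul_of_pairwise_orthogonal (w := fun j => T (u j))]
    · simp_rw [hμ]
    · intro j k hjk
      rw [huT, if_neg hjk]
  calc ∑ i, ‖T (e i)‖ ^ (2 * p)
      = ∑ i, (∑ j, ‖⟪u j, e' i⟫_ℂ‖ ^ 2 * μ j) ^ p := by
        refine Finset.sum_congr rfl fun i _ => ?_
        rw [← hT, Real.rpow_mul (norm_nonneg _), Real.rpow_two]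
    _ ≤ ∑ i, ∑ j, ‖⟪u j, e' i⟫_ℂ‖ ^ 2 * μ j ^ p := by
        refine Finset.sum_le_sum fun i _ => ?_
        refine Real.rpow_arith_mean_le_arith_mean_rpow _ _ _ (fun _ _ => by positivity) ?_
          (fun j _ => hμ0 j) hp
        rw [u.sum_sq_norm_inner_right, he'.1 i, one_pow]
    _ = ∑ j, (∑ i, ‖⟪e' i, u j⟫_ℂ‖ ^ 2) * μ j ^ p := by
        rw [Finset.sum_comm]
        refine Finset.sum_congr rfl fun j _ => ?_
        rw [Finset.sum_mul]
        simp_rw [norm_inner_symm]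
    _ ≤ ∑ j, μ j ^ p := by
        refine Finset.sum_le_sum fun j _ => ?_
        refine mul_le_of_le_one_left (Real.rpow_nonneg (hμ0 j) _) ?_
        refine he'.sum_inner_products_le (u j) |>.trans ?_
        rw [u.orthonormal.1 j, one_pow]
    _ ≤ _ := Finset.sum_le_sum fun j _ => hμs j

/-- A greedy choice of unit vectors, each orthogonal to the previous ones and almost norming `T` on
their complement, is stretched by `T` almost as much as the singular numbers. -/
theorem exists_orthonormal_sum_singularNumber_le [CompleteSpace H] (T : H →L[ℂ] H) {q : ℝ}
    (hq : 0 < q) {θ : ℝ} (h0 : 0 ≤ θ) (h1 : θ < 1) (n : ℕ) :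
    ∃ m ≤ n, ∃ e : Fin m → H, Orthonormal ℂ e ∧
      ∑ k ∈ Finset.range n, (θ * singularNumber T k) ^ q ≤ ∑ i, ‖T (e i)‖ ^ q := by
  induction n with
  | zero => exact ⟨0, le_rfl, ![], by simp, by simp⟩
  | succ n ih =>
    obtain ⟨m, hm, e, he, hsum⟩ := ih
    -- if `sₙ(T) = 0`, then nothing has to be added (and possibly nothing can be)
    rcases (singularNumber_nonneg T n).eq_or_lt' with hs | hs
    · refine ⟨m, by lia, e, he, ?_⟩
      rwa [Finset.sum_range_succ, hs, mul_zero, Real.zero_rpow hq.ne', add_zero]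
    let E := Submodule.span ℂ (Set.range e)
    have : FiniteDimensional ℂ E := FiniteDimensional.span_of_finite ℂ (Set.finite_range e)
    let P := Eᗮ.starProjection
    have hrank : ((T * E.starProjection : H →L[ℂ] H) : H →ₗ[ℂ] H).rank ≤ n := by
      refine (LinearMap.rank_comp_le_right _ _).trans ?_
      have h2 : LinearMap.range (E.starProjection : H →ₗ[ℂ] H) = E := E.range_starProjection
      rw [LinearMap.rank, h2]
      have h3 := Cardinal.mk_range_le_lift (f := e)
      rw [Cardinal.mk_fin, Cardinal.lift_natCast, Cardinal.lift_uzero] at h3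
      exact (rank_span_le _).trans (h3.trans (by exact_mod_cast hm))
    have hTP : T - T * E.starProjection = T * P := by
      have : P = 1 - E.starProjection := Submodule.starProjection_orthogonal' E
      rw [this, mul_sub, mul_one]
    have hlt : θ * singularNumber T n < ‖T * P‖ := by
      have := singularNumber_le T _ hrank
      rw [hTP] at this
      nlinarith
    obtain ⟨x, hx, hx'⟩ := ContinuousLinearMap.exists_lt_apply_of_lt_opNorm _ hlt
    set y := P x with hy
    change _ < ‖T y‖ at hx'
    have hyx : ‖y‖ ≤ 1 := (Submodule.norm_starProjection_apply_le _ _).trans hx.le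
    have hy0 : 0 < ‖y‖ := by
      rw [norm_pos_iff]
      rintro hy
      rw [hy, map_zero, norm_zero] at hx'
      exact absurd hx' (not_lt.2 (by positivity))
    have hyE : y ∈ Eᗮ := Submodule.starProjection_apply_mem _ _
    refine ⟨m + 1, by lia, Matrix.vecCons ((‖y‖⁻¹ : ℂ) • y) e, ?_, ?_⟩
    · rw [orthonormal_vecCons_iff]
      refine ⟨?_, fun i => ?_, he⟩
      · rw [norm_smul]; simp [hy0.ne']
      · rw [inner_smul_left, Submodule.inner_left_of_mem_orthogonal
          (K := E) (Submodule.subset_span (Set.mem_range_self i)) hyE, mul_zero]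
    · rw [Finset.sum_range_succ, Fin.sum_univ_succ, add_comm]
      refine add_le_add (Real.rpow_le_rpow (by positivity) ?_ hq.le) (by simpa using hsum)
      rw [Matrix.cons_val_zero, map_smul, norm_smul]
      refine hx'.le.trans (le_mul_of_one_le_left (norm_nonneg _) ?_)
      rw [norm_inv, Complex.norm_real, norm_norm]
      exact (one_le_inv₀ hy0).2 hyx

end SingularNumbers

end LCKasparov

/-! ### The Schatten classes as locally convex algebras -/

namespace LCKasparov

section Energy

variable {H : Type*} [NormedAddCommGroup H] [InnerProductSpace ℂ H]

/-- The `q`-th power `∑ₙ sₙ(T)^q` of the Schatten norm, meaningful for `T` with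
`MemSchatten q T`. -/
noncomputable def schattenEnergy (q : ℝ) (T : H →L[ℂ] H) : ℝ :=
  ∑' n, singularNumber T n ^ q

theorem schattenEnergy_nonneg (q : ℝ) (T : H →L[ℂ] H) : 0 ≤ schattenEnergy q T :=
  tsum_nonneg fun n => Real.rpow_nonneg (singularNumber_nonneg T n) q

theorem schattenEnergy_le_of_le {q : ℝ} (hq : 1 ≤ q) {S T : H →L[ℂ] H} {c : ℝ} (hc : 0 ≤ c)
    (hT : MemSchatten q T) (h : ∀ n, singularNumber S n ≤ c * singularNumber T n) :
    schattenEnergy q S ≤ c ^ q * schattenEnergy q T := by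
  rw [schattenEnergy, schattenEnergy, ← tsum_mul_left]
  refine Summable.tsum_le_tsum (fun n => ?_) (schatten_of_le hq hc hT h) (hT.mul_left _)
  rw [← Real.mul_rpow hc (singularNumber_nonneg _ _)]
  exact Real.rpow_le_rpow (singularNumber_nonneg _ _) (h n) (by linarith)

theorem schattenEnergy_add_le {q : ℝ} (hq : 1 ≤ q) {S T : H →L[ℂ] H}
    (hS : MemSchatten q S) (hT : MemSchatten q T) :
    schattenEnergy q (S + T) ≤ 2 * (2 ^ q * (schattenEnergy q S + schattenEnergy q T)) :=
  (schatten_add hq hS hT).2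

theorem memSchatten_mul_left {q : ℝ} (hq : 1 ≤ q) (S : H →L[ℂ] H) {T : H →L[ℂ] H}
    (hT : MemSchatten q T) : MemSchatten q (S * T) :=
  schatten_of_le hq (norm_nonneg S) hT (singularNumber_mul_le_left S T)

theorem memSchatten_mul_right {q : ℝ} (hq : 1 ≤ q) {S : H →L[ℂ] H} (T : H →L[ℂ] H)
    (hS : MemSchatten q S) : MemSchatten q (S * T) :=
  schatten_of_le hq (norm_nonneg T) hS fun n =>
    (singularNumber_mul_le_right S T n).trans_eq (mul_comm _ _)

theorem schattenEnergy_mul_left_le {q : ℝ} (hq : 1 ≤ q) (S : H →L[ℂ] H) {T : H →L[ℂ] H}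
    (hT : MemSchatten q T) : schattenEnergy q (S * T) ≤ ‖S‖ ^ q * schattenEnergy q T :=
  schattenEnergy_le_of_le hq (norm_nonneg S) hT (singularNumber_mul_le_left S T)

theorem schattenEnergy_mul_right_le {q : ℝ} (hq : 1 ≤ q) {S : H →L[ℂ] H} (T : H →L[ℂ] H)
    (hS : MemSchatten q S) : schattenEnergy q (S * T) ≤ ‖T‖ ^ q * schattenEnergy q S :=
  schattenEnergy_le_of_le hq (norm_nonneg T) hS fun n =>
    (singularNumber_mul_le_right S T n).trans_eq (mul_comm _ _)

theorem norm_rpow_le_schattenEnergy {q : ℝ} (hq : 1 ≤ q) {T : H →L[ℂ] H} (hT : MemSchatten q T) :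
    ‖T‖ ^ q ≤ schattenEnergy q T :=
  (Real.rpow_le_rpow (norm_nonneg _) (norm_le_singularNumber_zero T) (by linarith)).trans
    (hT.le_tsum 0 fun n _ => Real.rpow_nonneg (singularNumber_nonneg T n) q)

/-- The functional `T ↦ ∑ₙ sₙ(T)^(2p)` is convex: it is the supremum of the convex functionals
`∑ ‖T eᵢ‖^(2p)` over the finite orthonormal families `e`. -/
theorem schattenEnergy_convex [CompleteSpace H] {p : ℝ} (hp : 1 ≤ p) {S T : H →L[ℂ] H}
    (hS : MemSchatten (2 * p) S) (hT : MemSchatten (2 * p) T) {a b : ℝ} (ha : 0 ≤ a) (hb : 0 ≤ b)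
    (hab : a + b = 1) :
    schattenEnergy (2 * p) ((a : ℂ) • S + (b : ℂ) • T) ≤
      a * schattenEnergy (2 * p) S + b * schattenEnergy (2 * p) T := by
  set X := (a : ℂ) • S + (b : ℂ) • T with hX
  have hq : 0 < 2 * p := by linarith
  have hfam : ∀ {U : H →L[ℂ] H} (_ : MemSchatten (2 * p) U) {m : ℕ} {e : Fin m → H}
      (_ : Orthonormal ℂ e), ∑ i, ‖U (e i)‖ ^ (2 * p) ≤ schattenEnergy (2 * p) U := by
    intro U hU m e he
    refine (sum_norm_rpow_le_sum_singularNumber U hp he).trans ?_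
    rw [Fin.sum_univ_eq_sum_range (fun j => singularNumber U j ^ (2 * p))]
    exact hU.sum_le_tsum _ fun n _ => Real.rpow_nonneg (singularNumber_nonneg U n) _
  -- the greedy families lose a factor `θ < 1`, which disappears in the limit `θ → 1` below
  have hθ : ∀ n, ∀ θ : ℝ, 0 ≤ θ → θ < 1 →
      ∑ k ∈ Finset.range n, (θ * singularNumber X k) ^ (2 * p) ≤
      a * schattenEnergy (2 * p) S + b * schattenEnergy (2 * p) T := by
    intro n θ h0 h1
    obtain ⟨m, -, e, he, hsum⟩ := exists_orthonormal_sum_singularNumber_le X hq h0 h1 n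
    refine hsum.trans (le_trans ?_ (add_le_add (mul_le_mul_of_nonneg_left (hfam hS he) ha)
      (mul_le_mul_of_nonneg_left (hfam hT he) hb)))
    rw [Finset.mul_sum, Finset.mul_sum, ← Finset.sum_add_distrib]
    refine Finset.sum_le_sum fun i _ => ?_
    have hn : ‖X (e i)‖ ≤ a * ‖S (e i)‖ + b * ‖T (e i)‖ := by
      refine (norm_add_le _ _).trans_eq ?_
      simp [norm_smul, abs_of_nonneg ha, abs_of_nonneg hb]
    refine (Real.rpow_le_rpow (norm_nonneg _) hn hq.le).trans ?_
    exact (convexOn_rpow (by linarith : 1 ≤ 2 * p)).2 (norm_nonneg (S (e i)))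
      (norm_nonneg (T (e i))) ha hb hab
  refine Real.tsum_le_of_sum_range_le
    (fun n => Real.rpow_nonneg (singularNumber_nonneg X n) _) fun n => ?_
  have hcont : Continuous fun θ : ℝ =>
      ∑ k ∈ Finset.range n, (θ * singularNumber X k) ^ (2 * p) :=
    continuous_finsetSum _ fun k _ =>
      (continuous_id.mul continuous_const).rpow_const fun _ => Or.inr hq.le
  have hlim := (hcont.tendsto 1).mono_left (nhdsWithin_le_nhds (s := Set.Iio 1))
  simp only [one_mul] at hlim
  refine le_of_tendsto hlim ?_
  filter_upwards [Ioo_mem_nhdsLT (show (0 : ℝ) < 1 from one_pos)] with θ h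
  exact hθ n θ h.1.le h.2

end Energy

namespace SchattenClass

variable {H : Type*} [NormedAddCommGroup H] [InnerProductSpace ℂ H] {q : ℝ} {hq : 1 ≤ q}

instance : IsUniformAddGroup (SchattenClass H q hq) :=
  @isUniformAddGroup_of_addCommGroup _ _ (filterBasis H q hq).topology
    (filterBasis H q hq).isTopologicalAddGroup

theorem memSchatten_incl (T : SchattenClass H q hq) : MemSchatten q (incl H q hq T) := T.2

theorem incl_injective : Function.Injective (incl H q hq) := Subtype.val_injective

theorem mem_ball_iff_schattenEnergy_lt {r : ℝ} (hr : 0 < r) {T : SchattenClass H q hq} :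
    T ∈ ball H q hq r ↔ schattenEnergy q (incl H q hq T) < r ^ q :=
  mem_ball_iff hr T

theorem tendsto_iff {X : Type*} {l : Filter X} {f : X → SchattenClass H q hq}
    {T : SchattenClass H q hq} :
    Filter.Tendsto f l (𝓝 T) ↔
      Filter.Tendsto (fun x => schattenEnergy q (incl H q hq (f x) - incl H q hq T)) l (𝓝 0) := by
  have hq0 : 0 < q := by linarith
  rw [← tendsto_sub_nhds_zero_iff, nhds_zero_hasBasis.tendsto_right_iff]
  simp only [← map_sub]
  constructor
  · intro h
    refine tendsto_order.2 ⟨fun a ha => .of_forall fun x => ha.trans_le (schattenEnergy_nonneg _ _),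
      fun a ha => ?_⟩
    have hr : 0 < a ^ q⁻¹ := Real.rpow_pos_of_pos ha _
    filter_upwards [h _ hr] with x hx
    rwa [mem_ball_iff_schattenEnergy_lt hr, Real.rpow_inv_rpow ha.le hq0.ne'] at hx
  · intro h r hr
    filter_upwards [(tendsto_order.1 h).2 _ (Real.rpow_pos_of_pos hr q)] with x hx
    rwa [mem_ball_iff_schattenEnergy_lt hr]

/-- Continuity into the Schatten class, expressed through the bounded operators alone. -/
theorem isContinuousInto_incl_iff {X : Type*} [TopologicalSpace X] {g : X → H →L[ℂ] H} :
    IsContinuousInto (incl H q hq) g ↔ (∀ x, MemSchatten q (g x)) ∧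
      ∀ x, Filter.Tendsto (fun y => schattenEnergy q (g y - g x)) (𝓝 x) (𝓝 0) := by
  constructor
  · rintro ⟨h, hc, hg⟩
    obtain rfl : (fun x => incl H q hq (h x)) = g := funext hg
    exact ⟨fun x => memSchatten_incl _, fun x => tendsto_iff.1 (hc.tendsto x)⟩
  · rintro ⟨h1, h2⟩
    exact ⟨fun x => ⟨g x, h1 x⟩, continuous_iff_continuousAt.2 fun x => tendsto_iff.2 (h2 x),
      fun x => rfl⟩

theorem continuous_iff_isContinuousInto {X : Type*} [TopologicalSpace X]
    {f : X → SchattenClass H q hq} :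
    Continuous f ↔ IsContinuousInto (incl H q hq) fun x => incl H q hq (f x) := by
  refine ⟨fun h => ⟨f, h, fun _ => rfl⟩, ?_⟩
  rintro ⟨h, hc, hf⟩
  rwa [← show h = f from funext fun x => incl_injective (hf x)]

theorem _root_.LCKasparov.IsContinuousInto.add {X : Type*} [TopologicalSpace X]
    {f g : X → H →L[ℂ] H} (hf : IsContinuousInto (incl H q hq) f)
    (hg : IsContinuousInto (incl H q hq) g) :
    IsContinuousInto (incl H q hq) fun x => f x + g x := by
  obtain ⟨u, hu, huf⟩ := hf
  obtain ⟨v, hv, hvg⟩ := hg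
  exact ⟨fun x => u x + v x, hu.add hv, fun x => by rw [map_add, huf, hvg]⟩

theorem _root_.LCKasparov.IsContinuousInto.comp {X Y : Type*} [TopologicalSpace X]
    [TopologicalSpace Y] {g : X → H →L[ℂ] H} (hg : IsContinuousInto (incl H q hq) g) {f : Y → X}
    (hf : Continuous f) : IsContinuousInto (incl H q hq) fun y => g (f y) := by
  obtain ⟨h, hc, hh⟩ := hg
  exact ⟨fun y => h (f y), hc.comp hf, fun y => hh _⟩

theorem _root_.LCKasparov.IsContinuousInto.mul_left {X : Type*} [TopologicalSpace X]
    {f g : X → H →L[ℂ] H} (hf : Continuous f) (hg : IsContinuousInto (incl H q hq) g) :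
    IsContinuousInto (incl H q hq) fun x => f x * g x := by
  have hq0 : 0 < q := by linarith
  obtain ⟨h1, h2⟩ := isContinuousInto_incl_iff.1 hg
  refine isContinuousInto_incl_iff.2 ⟨fun x => memSchatten_mul_left hq _ (h1 x), fun x => ?_⟩
  have hsub : ∀ y, MemSchatten q (g y - g x) := fun y =>
    sub_mem (H := schattenSubalgebra H q hq) (h1 y) (h1 x)
  have hlim : Filter.Tendsto (fun y => 2 * (2 ^ q * (‖f y‖ ^ q * schattenEnergy q (g y - g x) +
      ‖f y - f x‖ ^ q * schattenEnergy q (g x)))) (𝓝 x)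
      (𝓝 (2 * (2 ^ q * (‖f x‖ ^ q * 0 + ‖f x - f x‖ ^ q * schattenEnergy q (g x))))) := by
    have h3 := ((hf.tendsto x).norm.rpow_const (Or.inr hq0.le : _ ∨ 0 ≤ q)).mul (h2 x)
    have h4 := (((hf.tendsto x).sub_const (f x)).norm.rpow_const
      (Or.inr hq0.le : _ ∨ 0 ≤ q)).mul_const (schattenEnergy q (g x))
    exact ((h3.add h4).const_mul _).const_mul _
  simp only [mul_zero, sub_self, norm_zero, Real.zero_rpow hq0.ne', zero_mul, add_zero] at hlim
  refine squeeze_zero (fun y => schattenEnergy_nonneg _ _) (fun y => ?_) hlim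
  have : f y * g y - f x * g x = f y * (g y - g x) + (f y - f x) * g x := by noncomm_ring
  rw [this]
  refine (schattenEnergy_add_le hq (memSchatten_mul_left hq _ (hsub y))
    (memSchatten_mul_left hq _ (h1 x))).trans ?_
  gcongr
  · exact schattenEnergy_mul_left_le hq _ (hsub y)
  · exact schattenEnergy_mul_left_le hq _ (h1 x)

theorem _root_.LCKasparov.IsContinuousInto.mul_right {X : Type*} [TopologicalSpace X]
    {f g : X → H →L[ℂ] H} (hg : IsContinuousInto (incl H q hq) g) (hf : Continuous f) :
    IsContinuousInto (incl H q hq) fun x => g x * f x := by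
  have hq0 : 0 < q := by linarith
  obtain ⟨h1, h2⟩ := isContinuousInto_incl_iff.1 hg
  refine isContinuousInto_incl_iff.2 ⟨fun x => memSchatten_mul_right hq _ (h1 x), fun x => ?_⟩
  have hsub : ∀ y, MemSchatten q (g y - g x) := fun y =>
    sub_mem (H := schattenSubalgebra H q hq) (h1 y) (h1 x)
  have hlim : Filter.Tendsto (fun y => 2 * (2 ^ q * (‖f y‖ ^ q * schattenEnergy q (g y - g x) +
      ‖f y - f x‖ ^ q * schattenEnergy q (g x)))) (𝓝 x)
      (𝓝 (2 * (2 ^ q * (‖f x‖ ^ q * 0 + ‖f x - f x‖ ^ q * schattenEnergy q (g x))))) := by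
    have h3 := ((hf.tendsto x).norm.rpow_const (Or.inr hq0.le : _ ∨ 0 ≤ q)).mul (h2 x)
    have h4 := (((hf.tendsto x).sub_const (f x)).norm.rpow_const
      (Or.inr hq0.le : _ ∨ 0 ≤ q)).mul_const (schattenEnergy q (g x))
    exact ((h3.add h4).const_mul _).const_mul _
  simp only [mul_zero, sub_self, norm_zero, Real.zero_rpow hq0.ne', zero_mul, add_zero] at hlim
  refine squeeze_zero (fun y => schattenEnergy_nonneg _ _) (fun y => ?_) hlim
  have : g y * f y - g x * f x = (g y - g x) * f y + g x * (f y - f x) := by noncomm_ring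
  rw [this]
  refine (schattenEnergy_add_le hq (memSchatten_mul_right hq _ (hsub y))
    (memSchatten_mul_right hq _ (h1 x))).trans ?_
  gcongr
  · exact schattenEnergy_mul_right_le hq _ (hsub y)
  · exact schattenEnergy_mul_right_le hq _ (h1 x)

theorem continuous_incl : Continuous (incl H q hq) := by
  have hq0 : 0 < q := by linarith
  refine continuous_iff_continuousAt.2 fun T => ?_
  have h : Filter.Tendsto (fun S => schattenEnergy q (incl H q hq S - incl H q hq T)) (𝓝 T) (𝓝 0) :=
    tendsto_iff.1 Filter.tendsto_id
  have h' := h.rpow_const (Or.inr (inv_nonneg.2 hq0.le) : _ ∨ 0 ≤ q⁻¹)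
  rw [Real.zero_rpow (inv_ne_zero hq0.ne')] at h'
  refine tendsto_iff_norm_sub_tendsto_zero.2
    (squeeze_zero (fun _ => norm_nonneg _) (fun S => ?_) h')
  rw [Real.le_rpow_inv_iff_of_pos (norm_nonneg _) (schattenEnergy_nonneg _ _) hq0, ← map_sub]
  exact norm_rpow_le_schattenEnergy hq (memSchatten_incl (S - T))

/-- Neighbourhoods of `0` are pulled back from the reals, so sequences suffice for completeness. -/
instance : (𝓝 (0 : SchattenClass H q hq)).IsCountablyGenerated := by
  have : 𝓝 (0 : SchattenClass H q hq) =
      (𝓝 (0 : ℝ)).comap fun T => schattenEnergy q (incl H q hq T - incl H q hq 0) :=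
    le_antisymm (Filter.map_le_iff_le_comap.1 (tendsto_iff.1 Filter.tendsto_id))
      (tendsto_iff.2 Filter.tendsto_comap : Filter.Tendsto id _ _)
  rw [this]
  infer_instance

theorem _root_.LCKasparov.continuous_singularNumber (n : ℕ) :
    Continuous fun T : H →L[ℂ] H => singularNumber T n := by
  refine (LipschitzWith.of_le_add fun S T => ?_).continuous (K := 1)
  have h1 := singularNumber_add_le T (S - T) (m := n) (n := 0) (k := n) le_rfl
  have h2 : singularNumber (S - T) 0 ≤ ‖S - T - 0‖ := singularNumber_le _ _ (by simp)
  rw [add_sub_cancel] at h1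
  rw [sub_zero] at h2
  rw [dist_eq_norm]
  linarith

instance [CompleteSpace H] : CompleteSpace (SchattenClass H q hq) := by
  have hq0 : 0 < q := by linarith
  have := IsUniformAddGroup.uniformity_countably_generated (α := SchattenClass H q hq)
  refine UniformSpace.complete_of_cauchySeq_tendsto fun u hu => ?_
  have hincl : UniformContinuous (incl H q hq) :=
    uniformContinuous_addMonoidHom_of_continuous continuous_incl
  obtain ⟨T, hT⟩ := cauchySeq_tendsto_of_complete (hincl.comp_cauchySeq hu)
  have hE : ∀ ε : ℝ, 0 < ε → ∃ N, ∀ m ≥ N, ∀ n ≥ N,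
      schattenEnergy q (incl H q hq (u m) - incl H q hq (u n)) < ε := by
    intro ε hε
    have h1 := cauchySeq_iff_tendsto.1 hu
    rw [uniformity_eq_comap_nhds_zero, Filter.tendsto_comap_iff, tendsto_iff] at h1
    obtain ⟨⟨M, N⟩, h⟩ := Filter.eventually_atTop.1 ((tendsto_order.1 h1).2 ε hε)
    refine ⟨max M N, fun m hm n hn => ?_⟩
    have := h (n, m) ⟨(le_max_left _ _).trans hn, (le_max_right _ _).trans hm⟩
    simpa using this
  have hsum : ∀ ε : ℝ, ∀ n N : ℕ, (∀ m ≥ N,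
      schattenEnergy q (incl H q hq (u n) - incl H q hq (u m)) < ε) → ∀ k,
      ∑ j ∈ Finset.range k, singularNumber (incl H q hq (u n) - T) j ^ q ≤ ε := by
    intro ε n N h k
    have hc : Continuous fun X : H →L[ℂ] H => ∑ j ∈ Finset.range k, singularNumber X j ^ q :=
      continuous_finsetSum _ fun j _ =>
        (continuous_singularNumber j).rpow_const fun _ => Or.inr hq0.le
    refine le_of_tendsto ((hc.tendsto _).comp (hT.const_sub (incl H q hq (u n)))) ?_
    filter_upwards [Filter.eventually_ge_atTop N] with m hm
    refine le_trans ?_ (h m hm).le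
    have := memSchatten_incl (u n - u m)
    rw [map_sub] at this
    exact this.sum_le_tsum _ fun j _ => Real.rpow_nonneg (singularNumber_nonneg _ j) q
  have hnn : ∀ n j, 0 ≤ singularNumber (incl H q hq (u n) - T) j ^ q := fun n j =>
    Real.rpow_nonneg (singularNumber_nonneg _ j) q
  obtain ⟨N, hN⟩ := hE 1 one_pos
  have hmem : MemSchatten q (incl H q hq (u N) - T) :=
    summable_of_sum_range_le (hnn N) (hsum 1 N N (hN N le_rfl))
  have hTmem : MemSchatten q T := by
    have := sub_mem (H := schattenSubalgebra H q hq) (memSchatten_incl (u N)) hmem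
    rwa [sub_sub_cancel] at this
  refine ⟨⟨T, hTmem⟩, tendsto_iff.2 (tendsto_order.2
    ⟨fun a ha => .of_forall fun x => ha.trans_le (schattenEnergy_nonneg _ _), fun a ha => ?_⟩)⟩
  obtain ⟨N, hN⟩ := hE (a / 2) (half_pos ha)
  filter_upwards [Filter.eventually_ge_atTop N] with n hn
  exact (Real.tsum_le_of_sum_range_le (hnn n) (hsum _ n N (hN n hn))).trans_lt (half_lt_self ha)

/-- For exponents at least `2` the Schatten class is a locally convex algebra. -/
theorem locallyConvexAlgebra [CompleteSpace H] {p : ℝ} (hp : 1 ≤ p) :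
    LocallyConvexAlgebra (SchattenClass H (2 * p) (one_le_two_mul hp)) where
  continuous_smul := by
    rw [continuous_iff_isContinuousInto]
    have := IsContinuousInto.mul_left (f := fun x : ℂ × _ => x.1 • (1 : H →L[ℂ] H))
      (continuous_fst.smul continuous_const) (continuous_iff_isContinuousInto.1
        (continuous_snd (X := ℂ) (Y := SchattenClass H (2 * p) (one_le_two_mul hp))))
    simpa only [smul_mul_assoc, one_mul, ← map_smul] using this
  continuous_mul := by
    rw [continuous_iff_isContinuousInto]
    simp only [map_mul]
    exact IsContinuousInto.mul_left (continuous_incl.comp continuous_fst)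
      (continuous_iff_isContinuousInto.1 continuous_snd)
  locallyConvex := by
    refine LocallyConvexSpace.ofBasisZero ℝ _ _ _ nhds_zero_hasBasis fun r hr => ?_
    intro S hS T hT a b ha hb hab
    rw [mem_ball_iff_schattenEnergy_lt hr] at hS hT ⊢
    rw [← Complex.coe_smul, ← Complex.coe_smul, map_add, map_smul, map_smul]
    refine (schattenEnergy_convex hp (memSchatten_incl S) (memSchatten_incl T)
      ha hb hab).trans_lt ?_
    exact convex_Iio (r ^ (2 * p)) hS hT ha hb hab

end SchattenClass
end LCKasparov

/-! ### Commutators and the equation `Y + T Y T = K² B K²` -/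

namespace LCKasparov

section Sandwich

variable {𝒜 : Type*} [NormedRing 𝒜] [NormedAlgebra ℂ 𝒜]

/-- The map `B ↦ ∑ₙ (-1)ⁿ Tⁿ X B Y Tⁿ`, meaningful when `‖Tⁿ X‖ ‖Y Tⁿ‖` is summable: the series is
taken in the space of bounded operators on `𝒜`, so that the continuity in `B` is built in. Its value
`Z` solves `Z + T Z T = X B Y`. -/
noncomputable def alternatingSandwich (T X Y : 𝒜) : 𝒜 →L[ℂ] 𝒜 :=
  ∑' n : ℕ, (-1 : ℂ) ^ n • ContinuousLinearMap.mulLeftRight ℂ 𝒜 (T ^ n * X) (Y * T ^ n)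

variable [CompleteSpace 𝒜] {T X Y : 𝒜}

theorem hasSum_alternatingSandwich (h : Summable fun n : ℕ => ‖T ^ n * X‖ * ‖Y * T ^ n‖) (B : 𝒜) :
    HasSum (fun n : ℕ => (-1 : ℂ) ^ n • (T ^ n * X * B * (Y * T ^ n)))
      (alternatingSandwich T X Y B) := by
  have hs : Summable fun n : ℕ =>
      (-1 : ℂ) ^ n • ContinuousLinearMap.mulLeftRight ℂ 𝒜 (T ^ n * X) (Y * T ^ n) := by
    refine Summable.of_norm_bounded h fun n => ?_
    rw [norm_smul, norm_pow, norm_neg, norm_one, one_pow, one_mul]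
    exact ContinuousLinearMap.opNorm_mulLeftRight_apply_apply_le ℂ 𝒜 _ _
  have := (ContinuousLinearMap.apply ℂ 𝒜 B).hasSum hs.hasSum
  simpa [alternatingSandwich] using this

theorem alternatingSandwich_add (h : Summable fun n : ℕ => ‖T ^ n * X‖ * ‖Y * T ^ n‖) (B : 𝒜) :
    alternatingSandwich T X Y B + T * alternatingSandwich T X Y B * T = X * B * Y := by
  have h1 := hasSum_alternatingSandwich h B
  have h2 := (h1.mul_left T).mul_right T
  have h3 := (hasSum_nat_add_iff' 1).2 h1
  have h4 : ∀ n : ℕ, T * ((-1 : ℂ) ^ n • (T ^ n * X * B * (Y * T ^ n))) * T =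
      -((-1 : ℂ) ^ (n + 1) • (T ^ (n + 1) * X * B * (Y * T ^ (n + 1)))) := by
    intro n
    have h6 : T ^ (n + 1) * X * B * (Y * T ^ (n + 1)) = T * (T ^ n * X * B * (Y * T ^ n)) * T := by
      nth_rewrite 1 [pow_succ']
      rw [pow_succ]
      simp only [mul_assoc]
    rw [h6, pow_succ (-1 : ℂ), mul_neg_one, neg_smul, neg_neg, mul_smul_comm, smul_mul_assoc]
  simp only [h4] at h2
  have h5 := h2.unique h3.neg
  simp only [Finset.sum_range_one, pow_zero, one_smul, one_mul, mul_one, neg_sub] at h5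
  rw [h5, add_sub_cancel]

end Sandwich

section CStar

variable {𝒜 : Type*} [CStarAlgebra 𝒜] [PartialOrder 𝒜] [StarOrderedRing 𝒜]

theorem norm_pow_mul_one_sub_le {x : 𝒜} (h0 : 0 ≤ x) (h1 : x ≤ 1) (n : ℕ) :
    ‖x ^ n * (1 - x)‖ ≤ 1 / (n + 1) := by
  have : x ^ n * (1 - x) = cfc (fun t : ℝ => t ^ n * (1 - t)) x := by
    rw [cfc_mul .., cfc_pow_id .., cfc_sub .., cfc_const_one .., cfc_id' ..]
  rw [this]
  refine norm_cfc_le (by positivity) fun t ht => ?_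
  have a : 0 ≤ t := spectrum_nonneg_of_nonneg h0 ht
  have b : t ≤ 1 :=
    (le_algebraMap_iff_spectrum_le (r := (1 : ℝ)) (a := x)).1 (by simpa using h1) t ht
  rw [Real.norm_of_nonneg (mul_nonneg (pow_nonneg a n) (by linarith)), le_div_iff₀ (by positivity)]
  have h2 := mul_neg_geom_sum t (n + 1)
  have h3 : (n + 1) * t ^ n ≤ ∑ i ∈ Finset.range (n + 1), t ^ i := by
    have : ∑ i ∈ Finset.range (n + 1), t ^ n ≤ ∑ i ∈ Finset.range (n + 1), t ^ i :=
      Finset.sum_le_sum fun i hi =>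
        pow_le_pow_of_le_one a b (by rw [Finset.mem_range] at hi; lia)
    simpa using this
  have : 0 ≤ t ^ (n + 1) := by positivity
  nlinarith

variable {T K : 𝒜}

theorem norm_pow_mul_le (hT : IsSelfAdjoint T) (hK : IsSelfAdjoint K) (hc : Commute T K)
    (h : K * K = 1 - T * T) (n : ℕ) : ‖T ^ n * K‖ ≤ ((n : ℝ) + 1) ^ (-(1 / 2) : ℝ) := by
  have h0 : 0 ≤ T * T := by simpa [hT.star_eq] using star_mul_self_nonneg T
  have h1 : T * T ≤ 1 := by
    rw [← sub_nonneg, ← h]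
    simpa [hK.star_eq] using star_mul_self_nonneg K
  have hs : IsSelfAdjoint (T ^ n * K) := by
    rw [isSelfAdjoint_iff, star_mul, star_pow, hT.star_eq, hK.star_eq]
    exact (hc.pow_left n).eq.symm
  have h2 : (T ^ n * K) * (T ^ n * K) = (T * T) ^ n * (1 - T * T) := by
    rw [← h, (Commute.refl T).mul_pow]
    have := (hc.pow_left n).eq
    calc T ^ n * K * (T ^ n * K) = T ^ n * (K * T ^ n) * K := by simp only [mul_assoc]
      _ = _ := by rw [← this]; simp only [mul_assoc]
  have h3 := norm_pow_mul_one_sub_le h0 h1 n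
  rw [← h2, hs.norm_mul_self] at h3
  refine le_of_sq_le_sq (h3.trans_eq ?_) (by positivity)
  rw [← Real.rpow_natCast, ← Real.rpow_mul (by positivity)]
  norm_num [Real.rpow_neg_one]

theorem norm_pow_mul_mul_le (hT : IsSelfAdjoint T) (hK : IsSelfAdjoint K) (hc : Commute T K)
    (h : K * K = 1 - T * T) (n : ℕ) : ‖T ^ n * (K * K)‖ ≤ 2 * ((n : ℝ) + 1)⁻¹ := by
  -- `T` is not positive, so the power is split into halves instead of taking a square root of it
  have h1 : T ^ n * (K * K) = (T ^ (n / 2) * K) * (T ^ (n - n / 2) * K) := by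
    have h2 := (hc.pow_left (n - n / 2)).eq
    calc T ^ n * (K * K) = T ^ (n / 2) * (T ^ (n - n / 2) * K) * K := by
          rw [show T ^ n = T ^ (n / 2) * T ^ (n - n / 2) by rw [← pow_add]; congr 1; lia]
          simp only [mul_assoc]
      _ = _ := by simp only [mul_assoc, h2]
  have hb : ∀ m : ℕ, n ≤ 2 * m + 1 → ‖T ^ m * K‖ ≤ (((n : ℝ) + 1) / 2) ^ (-(1 / 2) : ℝ) := by
    intro m hm
    refine (norm_pow_mul_le hT hK hc h m).trans ?_
    have : (n : ℝ) ≤ 2 * m + 1 := by exact_mod_cast hm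
    exact Real.rpow_le_rpow_of_nonpos (by positivity) (by linarith) (by norm_num)
  rw [h1]
  refine (norm_mul_le _ _).trans ((mul_le_mul (hb _ (by lia)) (hb _ (by lia)) (norm_nonneg _)
    (by positivity)).trans_eq ?_)
  rw [← Real.rpow_add (by positivity)]
  norm_num [Real.rpow_neg_one]
  ring

/-- The terms are `O(n^(-3/2))`, so a sandwich series with one factor `K` on one side and two on the
other converges absolutely. With one factor on each side the bound would only be `O(n⁻¹)`. -/
theorem summable_norm_pow_mul (hT : IsSelfAdjoint T) (hK : IsSelfAdjoint K) (hc : Commute T K)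
    (h : K * K = 1 - T * T) : Summable fun n : ℕ => ‖T ^ n * K‖ * ‖T ^ n * (K * K)‖ := by
  have hs : Summable fun n : ℕ => 2 * ((n : ℝ) + 1) ^ (-(3 / 2) : ℝ) := by
    refine Summable.mul_left _ ?_
    have := (summable_nat_add_iff 1).2 (Real.summable_nat_rpow.2
      (show (-(3 / 2) : ℝ) < -1 by norm_num))
    simpa using this
  refine Summable.of_nonneg_of_le (fun n => by positivity) (fun n => ?_) hs
  refine (mul_le_mul (norm_pow_mul_le hT hK hc h n) (norm_pow_mul_mul_le hT hK hc h n)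
    (norm_nonneg _) (by positivity)).trans_eq ?_
  rw [← Real.rpow_neg_one, mul_left_comm, ← Real.rpow_add (by positivity)]
  norm_num

/-- Iterating the equation gives `E = ± Tⁿ E Tⁿ`, and `‖Tⁿ K²‖` tends to `0`. -/
theorem mul_eq_zero_of_eq_neg_mul_mul (hT : IsSelfAdjoint T) (hK : IsSelfAdjoint K)
    (hc : Commute T K) (h : K * K = 1 - T * T) {E : 𝒜} (hE : E = -(T * E * T)) :
    E * (K * K) = 0 := by
  have hTn : ‖T‖ ≤ 1 := by
    have h0 : 0 ≤ T * T := by simpa [hT.star_eq] using star_mul_self_nonneg T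
    have h1 : T * T ≤ 1 := by
      rw [← sub_nonneg, ← h]
      simpa [hK.star_eq] using star_mul_self_nonneg K
    have := (CStarAlgebra.norm_le_one_iff_of_nonneg _ h0).2 h1
    rw [hT.norm_mul_self] at this
    exact le_of_sq_le_sq (by simpa using this) one_pos.le
  have hn : ∀ n : ℕ, E = T ^ n * E * T ^ n ∨ E = -(T ^ n * E * T ^ n) := by
    intro n
    induction n with
    | zero => simp
    | succ n ih =>
      have h1 : T ^ (n + 1) * E * T ^ (n + 1) = T * (T ^ n * E * T ^ n) * T := by
        nth_rewrite 1 [pow_succ']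
        rw [pow_succ]
        simp only [mul_assoc]
      rw [h1]
      rcases ih with ih | ih
      · right; rw [← ih]; exact hE
      · left
        rw [← neg_eq_iff_eq_neg.2 ih, mul_neg, neg_mul]
        exact hE
  have hb : ∀ n : ℕ, ‖E * (K * K)‖ ≤ ‖E‖ * (2 * (1 / ((n : ℝ) + 1))) := by
    intro n
    have h1 : ‖E * (K * K)‖ = ‖T ^ n * E * (T ^ n * (K * K))‖ := by
      rw [← mul_assoc (T ^ n * E)]
      rcases hn n with h2 | h2
      · rw [← h2]
      · rw [← norm_neg (T ^ n * E * T ^ n * (K * K)), ← neg_mul, ← h2]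
    have h3 : ∀ m : ℕ, ‖T ^ m * E‖ ≤ ‖E‖ := by
      intro m
      induction m with
      | zero => simp
      | succ m ih =>
        rw [pow_succ', mul_assoc]
        exact (norm_mul_le _ _).trans ((mul_le_of_le_one_left (norm_nonneg _) hTn).trans ih)
    rw [h1, one_div]
    exact (norm_mul_le _ _).trans (mul_le_mul (h3 n) (norm_pow_mul_mul_le hT hK hc h n)
      (norm_nonneg _) (norm_nonneg _))
  have hlim := (tendsto_one_div_add_atTop_nhds_zero_nat (𝕜 := ℝ)).const_mul 2 |>.const_mul ‖E‖
  rw [mul_zero, mul_zero] at hlim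
  exact norm_le_zero_iff.1 (ge_of_tendsto' hlim hb)

/-- Solving the equation `Y + T Y T = K² B K²` by a sandwich series: the right-hand side has two
factors `K` on the left, of which one suffices for convergence, so that one factor `K` can be pulled
out of the solution on either side. The solution is unique as `T ^ n * K²` tends to `0`. -/
theorem eq_mul_alternatingSandwich (hT : IsSelfAdjoint T) (hK : IsSelfAdjoint K)
    (hc : Commute T K) (h : K * K = 1 - T * T) (hd : ∀ E : 𝒜, E * (K * K) = 0 → E = 0) {Y B : 𝒜}
    (hY : Y + T * Y * T = K * K * B * (K * K)) :
    Y = K * alternatingSandwich T K (K * K) B ∧ Y = alternatingSandwich T (K * K) K B * K := by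
  have hcp : ∀ n : ℕ, K * T ^ n = T ^ n * K := fun n => (hc.pow_left n).eq.symm
  have hcp2 : ∀ n : ℕ, K * K * T ^ n = T ^ n * (K * K) := fun n =>
    ((hc.mul_right hc).pow_left n).eq.symm
  have hs := summable_norm_pow_mul hT hK hc h
  have h1 := alternatingSandwich_add (T := T) (X := K) (Y := K * K)
    (by simpa only [hcp2] using hs) B
  have h2 := alternatingSandwich_add (T := T) (X := K * K) (Y := K)
    (by simpa only [hcp, mul_comm] using hs) B
  set Z := alternatingSandwich T K (K * K) B
  set Z' := alternatingSandwich T (K * K) K B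
  have huniq : ∀ W : 𝒜, W + T * W * T = K * K * B * (K * K) → Y = W := by
    intro W hW
    refine sub_eq_zero.1 (hd _ (mul_eq_zero_of_eq_neg_mul_mul hT hK hc h ?_))
    linear_combination (norm := noncomm_ring) hY - hW
  refine ⟨huniq _ ?_, huniq _ ?_⟩
  · linear_combination (norm := noncomm_ring) K * h1 + hc.eq * Z * T
  · linear_combination (norm := noncomm_ring) h2 * K - T * Z' * hc.eq

variable {R F : 𝒜}

/-- Commutators with a bounded transform factor through a square root `K` of `2 R (1 + R)⁻¹` on
either side. Here `F = D R` with `R = (1 + D²)^(-1/2)`, and `B` stands for the commutator `[D, c]`,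
which enters through the bounded relation `F c R - R c F = R B R` only.

In terms of `T = F (1 + R)⁻¹`, a half-angle tangent if `F` is a sine and `R` a cosine, this relation
reads `Y + T Y T = K² (B / 2) K²` with `Y = [T, c]`. The commutator is recovered from
`2 [F, c] = (1 + R) Y (1 + R) - F Y F`, and `1 + R` and `F` commute with `K`. -/
theorem exists_commutator_factorization (hR : 0 ≤ R) (hF : IsSelfAdjoint F) (hc : Commute F R)
    (hFR : F * F + R * R = 1) (hd : ∀ E : 𝒜, E * R = 0 → E = 0) :
    ∃ (K J Q : 𝒜) (Λ₁ Λ₂ : 𝒜 → 𝒜), Continuous Λ₁ ∧ Continuous Λ₂ ∧ IsSelfAdjoint K ∧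
      K * K = R * J ∧ K * K = J * R ∧ R * R = K * Q ∧ R * R = Q * K ∧
      ∀ c B, F * c * R - R * c * F = R * B * R →
        c * F - F * c = K * Λ₁ B ∧ c * F - F * c = Λ₂ B * K := by
  have hRs : IsSelfAdjoint R := .of_nonneg hR
  obtain ⟨u, hu⟩ : IsUnit (1 + R) :=
    CStarAlgebra.isUnit_of_le 1 (le_add_of_nonneg_right hR) isStrictlyPositive_one
  let L : 𝒜 := ↑u⁻¹
  have hL1 : L * (1 + R) = 1 := by rw [← hu]; exact u.inv_mul
  have hL2 : (1 + R) * L = 1 := by rw [← hu]; exact u.mul_inv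
  have hLs : IsSelfAdjoint L := by
    rw [isSelfAdjoint_iff]
    have : star L * (1 + R) = 1 := by
      have := congrArg star hL2
      simpa [hRs.star_eq] using this
    exact left_inv_eq_right_inv this hL2
  have hcomm : ∀ {x : 𝒜}, Commute x R → Commute x L := fun {x} hx => by
    have : Commute x (u : 𝒜) := by rw [hu]; exact (Commute.one_right x).add_right hx
    exact this.units_inv_right
  have hRL : Commute R L := hcomm (Commute.refl R)
  have hFL : Commute F L := hcomm hc
  have hL0 : 0 ≤ L := by
    have := star_left_conjugate_nonneg (add_nonneg zero_le_one hR : 0 ≤ 1 + R) L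
    rwa [hLs.star_eq, hL1, one_mul] at this
  have hRL0 : 0 ≤ R * L + R * L :=
    add_nonneg (Commute.mul_nonneg hR hL0 hRL) (Commute.mul_nonneg hR hL0 hRL)
  obtain ⟨K, hK⟩ : ∃ K, K = CFC.sqrt (R * L + R * L) := ⟨_, rfl⟩
  have hKK : K * K = R * L + R * L := by rw [hK]; exact CFC.sqrt_mul_sqrt_self _ hRL0
  have hKs : IsSelfAdjoint K := by rw [hK]; exact .of_nonneg (CFC.sqrt_nonneg _)
  have hKc : ∀ {x : 𝒜}, Commute x R → Commute K x := fun {x} hx =>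
    have h := hx.mul_right (hcomm hx)
    hK ▸ Commute.cfcₙ_nnreal (h.add_right h).symm _
  obtain ⟨T, hT⟩ : ∃ T, T = F * L := ⟨_, rfl⟩
  have hTs : IsSelfAdjoint T := by
    rw [hT, isSelfAdjoint_iff, star_mul, hF.star_eq, hLs.star_eq, hFL.eq]
  have hTR : Commute T R := hT ▸ hc.mul_left hRL.symm
  have hTK : Commute T K := (hKc hTR).symm
  have hKT : K * K = 1 - T * T := by
    rw [hKK, hT]
    linear_combination (norm := noncomm_ring)
      -(F * hFL.eq * L) + hFR * L * L - R * hL2 * L + hL2 * L + hL2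
  have hRKK : R + R = K * K * (1 + R) := by
    rw [hKK]
    linear_combination (norm := noncomm_ring) (-2 : 𝒜) * R * hL1
  have hhalf : ∀ {x y : 𝒜}, x + x = y → x = (1 / 2 : ℝ) • y := by
    rintro x _ rfl
    rw [← two_smul ℝ x, smul_smul]
    norm_num
  have hd' : ∀ E : 𝒜, E * (K * K) = 0 → E = 0 := fun E hE => by
    refine hd E ?_
    have : E * R + E * R = 0 := by
      rw [← mul_add, hRKK, ← mul_assoc, hE, zero_mul]
    rw [hhalf this, smul_zero]
  have hKF : Commute K F := hKc hc
  have hKR : Commute K R := hKc (Commute.refl R)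
  have hLR := hRL.eq
  refine ⟨K, L + L, (1 / 2 : ℝ) • (K * (1 + R) * R),
    fun B => (1 / 2 : ℝ) • (F * alternatingSandwich T K (K * K) ((1 / 2 : ℝ) • B) * F -
      (1 + R) * alternatingSandwich T K (K * K) ((1 / 2 : ℝ) • B) * (1 + R)),
    fun B => (1 / 2 : ℝ) • (F * alternatingSandwich T (K * K) K ((1 / 2 : ℝ) • B) * F -
      (1 + R) * alternatingSandwich T (K * K) K ((1 / 2 : ℝ) • B) * (1 + R)),
    by fun_prop, by fun_prop, hKs, by rw [hKK, mul_add], by rw [hKK, add_mul, hLR], ?_, ?_, ?_⟩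
  · rw [mul_smul_comm]
    exact hhalf (by linear_combination (norm := noncomm_ring) hRKK * R)
  · rw [smul_mul_assoc]
    refine hhalf ?_
    have h1 := hKR.eq
    linear_combination (norm := noncomm_ring) hRKK * R + K * h1 + K * h1 * R + K * R * h1
  intro c B hcB
  obtain ⟨B', hB'⟩ : ∃ B', B' = (1 / 2 : ℝ) • B := ⟨_, rfl⟩
  have hBB : B' + B' = B := by
    rw [hB', ← two_smul ℝ, smul_smul]
    norm_num
  have hY : (T * c - c * T) + T * (T * c - c * T) * T = K * K * B' * (K * K) := by
    have h1 : (T * c - c * T) + T * (T * c - c * T) * T = T * c * (K * K) - K * K * c * T := by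
      rw [hKT]; noncomm_ring
    have h2 : T = L * F := by rw [hT, hFL.eq]
    have h3 : K * K = (L + L) * R := by rw [hKK, add_mul, hLR]
    have h4 : T * c * (K * K) = L * F * c * (R * L + R * L) := by rw [hKK, h2]
    have h5 : K * K * c * T = (L + L) * R * c * (F * L) := by rw [h3, hT]
    have h6 : K * K * B' * (K * K) = (L + L) * R * B' * (R * L + R * L) := by
      nth_rewrite 1 [h3]
      rw [hKK]
    rw [h1, h4, h5, h6]
    rw [← hBB] at hcB
    linear_combination (norm := noncomm_ring) 2 * L * hcB * L
  obtain ⟨hY1, hY2⟩ := eq_mul_alternatingSandwich hTs hKs hTK hKT hd' hY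
  have hTU : T * (1 + R) = F := by rw [hT, mul_assoc, hL1, mul_one]
  have hUT : (1 + R) * T = F := by
    rw [← hTU, mul_add, add_mul, hTR.eq, mul_one, one_mul]
  have hTF : T * F = 1 - R := by
    have : T * T * (1 + R) = 1 - R := by
      rw [show T * T = 1 - K * K by rw [hKT]; abel]
      linear_combination (norm := noncomm_ring) hRKK
    rw [← this, mul_assoc, hTU]
  have hFT : F * T = 1 - R := by
    rw [← hTF]
    nth_rewrite 1 [← hTU]
    rw [mul_assoc, hUT]
  have hmain : c * F - F * c = (1 / 2 : ℝ) • (F * (T * c - c * T) * F -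
      (1 + R) * (T * c - c * T) * (1 + R)) := by
    refine hhalf ?_
    linear_combination (norm := noncomm_ring)
      -hFT * c * F + F * c * hTF + hUT * c * (1 + R) - (1 + R) * c * hTU
  simp only [hmain, ← hB']
  constructor
  · rw [hY1, mul_smul_comm]
    congr 1
    generalize alternatingSandwich T K (K * K) B' = Z
    linear_combination (norm := noncomm_ring) -hKF.eq * Z * F + hKR.eq * Z * (1 + R)
  · rw [hY2, smul_mul_assoc]
    congr 1
    generalize alternatingSandwich T (K * K) K B' = Z
    linear_combination (norm := noncomm_ring) F * Z * hKF.eq - (1 + R) * Z * hKR.eq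

end CStar
end LCKasparov

/-! ### Operators whose square lies in a Schatten class -/

namespace LCKasparov

section TwoMul

variable {H : Type*} [NormedAddCommGroup H] [InnerProductSpace ℂ H]

theorem schattenEnergy_two_mul_le {p : ℝ} (hp : 1 ≤ p) {X Y : H →L[ℂ] H} {c : ℝ} (hc : 0 ≤ c)
    (hY : MemSchatten p Y) (h : ∀ n, singularNumber X n ^ 2 ≤ c * singularNumber Y n) :
    MemSchatten (2 * p) X ∧ schattenEnergy (2 * p) X ≤ c ^ p * schattenEnergy p Y := by
  have hle : ∀ n, singularNumber X n ^ (2 * p) ≤ c ^ p * singularNumber Y n ^ p := by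
    intro n
    rw [← Real.mul_rpow hc (singularNumber_nonneg _ _), Real.rpow_mul (singularNumber_nonneg _ _),
      Real.rpow_two]
    exact Real.rpow_le_rpow (sq_nonneg _) (h n) (by linarith)
  have hs : MemSchatten (2 * p) X :=
    Summable.of_nonneg_of_le (fun n => Real.rpow_nonneg (singularNumber_nonneg _ _) _) hle
      (hY.mul_left _)
  refine ⟨hs, ?_⟩
  rw [schattenEnergy, schattenEnergy, ← tsum_mul_left]
  exact hs.tsum_le_tsum hle (hY.mul_left _)

/-- An additive map `g` is continuous into `L^(2p)` if `sₙ(g a)²` is dominated by the singular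
numbers of a continuous additive map into `L^p`. -/
theorem isContinuousInto_two_mul {A : Type*} [AddGroup A] [TopologicalSpace A] {p : ℝ} (hp : 1 ≤ p)
    {g y z : A →+ (H →L[ℂ] H)} (hy : IsContinuousInto (SchattenClass.incl H p hp) y)
    (hz : Continuous z) (h : ∀ a n, singularNumber (g a) n ^ 2 ≤ ‖z a‖ * singularNumber (y a) n) :
    IsContinuousInto (SchattenClass.incl H (2 * p) (one_le_two_mul hp)) g := by
  have hp0 : 0 < p := by linarith
  obtain ⟨h1, h2⟩ := SchattenClass.isContinuousInto_incl_iff.1 hy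
  have key := fun a => schattenEnergy_two_mul_le hp (norm_nonneg (z a)) (h1 a) (h a)
  refine SchattenClass.isContinuousInto_incl_iff.2 ⟨fun a => (key a).1, fun a => ?_⟩
  have hlim := (((hz.tendsto a).sub_const (z a)).norm.rpow_const (Or.inr hp0.le : _ ∨ 0 ≤ p)).mul
    (h2 a)
  rw [mul_zero] at hlim
  refine squeeze_zero (fun b => schattenEnergy_nonneg _ _) (fun b => ?_) hlim
  simpa only [map_sub] using (key (b - a)).2

end TwoMul

section SquareRoot

variable {H : Type*} [NormedAddCommGroup H] [InnerProductSpace ℂ H] [CompleteSpace H]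

/-- A bounded operator of rank at most `n` vanishes on the range of a projection of corank at
most `n`. -/
theorem exists_starProjection_of_rank_le {A : H →L[ℂ] H} {n : ℕ}
    (hA : (A : H →ₗ[ℂ] H).rank ≤ n) :
    ∃ P : H →L[ℂ] H, IsSelfAdjoint P ∧ ‖P‖ ≤ 1 ∧ A * P = 0 ∧
      ((1 - P : H →L[ℂ] H) : H →ₗ[ℂ] H).rank ≤ n := by
  let N : Submodule ℂ H := LinearMap.ker (A : H →ₗ[ℂ] H)
  have : CompleteSpace N := A.isClosed_ker.completeSpace_coe
  refine ⟨N.starProjection, isSelfAdjoint_starProjection N, N.starProjection_norm_le, ?_, ?_⟩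
  · ext x
    exact N.starProjection_apply_mem x
  · rw [← Submodule.starProjection_orthogonal', LinearMap.rank]
    have h2 : LinearMap.range (Nᗮ.starProjection : H →ₗ[ℂ] H) = Nᗮ := Nᗮ.range_starProjection
    rw [h2]
    refine le_trans (LinearMap.rank_le_of_injective
      ((A : H →ₗ[ℂ] H).rangeRestrict.domRestrict Nᗮ) ?_) hA
    rw [← LinearMap.ker_eq_bot, LinearMap.ker_eq_bot']
    rintro ⟨x, hx⟩ h
    have hxN : x ∈ N := congrArg Subtype.val h
    exact Subtype.ext (inner_self_eq_zero.1 (hx x hxN))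

theorem singularNumber_sq_le_star_mul_self (X : H →L[ℂ] H) (n : ℕ) :
    singularNumber X n ^ 2 ≤ singularNumber (star X * X) n := by
  refine le_ciInf fun ⟨A, hA⟩ => ?_
  obtain ⟨P, hP, hP1, hAP, hr⟩ := exists_starProjection_of_rank_le hA
  have h1 : singularNumber X n ≤ ‖X * P‖ := by
    refine (singularNumber_le X (X * (1 - P))
      ((LinearMap.rank_comp_le_right _ _).trans hr)).trans_eq ?_
    congr 1
    noncomm_ring
  have h2 : ‖X * P‖ ^ 2 = ‖P * (star X * X - A) * P‖ := by
    rw [sq, ← CStarRing.norm_star_mul_self, star_mul, hP.star_eq]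
    congr 1
    linear_combination (norm := noncomm_ring) P * hAP
  have h3 : ‖P * (star X * X - A) * P‖ ≤ 1 * ‖star X * X - A‖ * 1 :=
    (norm_mul₃_le).trans (by gcongr)
  calc singularNumber X n ^ 2 ≤ ‖X * P‖ ^ 2 := by
        have := singularNumber_nonneg X n
        gcongr
    _ ≤ _ := by rw [h2]; simpa using h3

theorem singularNumber_sq_le_mul_star_self (X : H →L[ℂ] H) (n : ℕ) :
    singularNumber X n ^ 2 ≤ singularNumber (X * star X) n := by
  refine le_ciInf fun ⟨A, hA⟩ => ?_
  obtain ⟨P, hP, hP1, hAP, hr⟩ := exists_starProjection_of_rank_le hA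
  have h1 : singularNumber X n ≤ ‖P * X‖ := by
    refine (singularNumber_le X ((1 - P) * X)
      ((LinearMap.rank_comp_le_left _ _).trans hr)).trans_eq ?_
    congr 1
    noncomm_ring
  have h2 : ‖P * X‖ ^ 2 = ‖P * (X * star X - A) * P‖ := by
    rw [sq, ← CStarRing.norm_self_mul_star, star_mul, hP.star_eq]
    congr 1
    linear_combination (norm := noncomm_ring) P * hAP
  have h3 : ‖P * (X * star X - A) * P‖ ≤ 1 * ‖X * star X - A‖ * 1 :=
    (norm_mul₃_le).trans (by gcongr)
  calc singularNumber X n ^ 2 ≤ ‖P * X‖ ^ 2 := by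
        have := singularNumber_nonneg X n
        gcongr
    _ ≤ _ := by rw [h2]; simpa using h3

end SquareRoot

/-! ### The bounded transform of a self-adjoint operator -/

section BoundedTransform

variable {H : Type*} [NormedAddCommGroup H] [InnerProductSpace ℂ H] [CompleteSpace H]
  {D : H →ₗ.[ℂ] H}

theorem oneAddSqInvSqrt_mul_self (hD : IsSelfAdjoint D) :
    oneAddSqInvSqrt D * oneAddSqInvSqrt D = oneAddSqInv D :=
  CFC.sqrt_mul_sqrt_self _ (oneAddSqInv_nonneg hD)

theorem oneAddSqInvSqrt_nonneg : 0 ≤ oneAddSqInvSqrt D := CFC.sqrt_nonneg _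

theorem inner_oneAddSqInvSqrt (x y : H) :
    ⟪oneAddSqInvSqrt D x, y⟫_ℂ = ⟪x, oneAddSqInvSqrt D y⟫_ℂ :=
  ((ContinuousLinearMap.nonneg_iff_isPositive _).1 oneAddSqInvSqrt_nonneg).isSymmetric x y

theorem oneAddSqInvSqrt_injective (hD : IsSelfAdjoint D) {x : H} (h : oneAddSqInvSqrt D x = 0) :
    x = 0 := by
  obtain ⟨a, c, ha, hc, hx⟩ := oneAddSqInv_spec hD x
  have h0 : oneAddSqInv D x = 0 := by
    rw [← oneAddSqInvSqrt_mul_self hD, mul_apply_eq_comp, h, map_zero]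
  have ha0 : a = 0 := Subtype.ext (by rw [ha, h0]; rfl)
  have hc0 : c = 0 := Subtype.ext (by rw [hc, ha0, LinearPMap.map_zero]; rfl)
  rw [← hx, ha0, hc0, LinearPMap.map_zero, add_zero]
  rfl

theorem eq_zero_of_mul_oneAddSqInvSqrt (hD : IsSelfAdjoint D) {E : H →L[ℂ] H}
    (h : E * oneAddSqInvSqrt D = 0) : E = 0 := by
  have hRs := (IsSelfAdjoint.of_nonneg (oneAddSqInvSqrt_nonneg (D := D))).star_eq
  have hs : oneAddSqInvSqrt D * star E = 0 := by
    have := congrArg star h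
    rwa [star_mul, hRs, star_zero] at this
  rw [← star_eq_zero]
  ext x
  exact oneAddSqInvSqrt_injective hD (congrArg (fun T : H →L[ℂ] H => T x) hs)

/-- `R² D ⊆ D R²`, where `R² = (1 + D²)⁻¹`. -/
theorem oneAddSqInv_apply_map (hD : IsSelfAdjoint D) (z : D.domain) :
    ∃ a : D.domain, (a : H) = oneAddSqInv D z ∧ oneAddSqInv D (D z) = D a := by
  obtain ⟨a, c, ha, hc, hx⟩ := oneAddSqInv_spec hD (z : H)
  have hd : ((z - a : D.domain) : H) = D c := by
    rw [Submodule.coe_sub, ← hx, add_sub_cancel_left]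
  refine ⟨a, ha, ?_⟩
  rw [← hc]
  refine oneAddSqInv_apply_eq hD c _ hd ?_
  rw [LinearPMap.map_sub, hc]
  abel

theorem boundedTransform_apply (hD : IsSelfAdjoint D) {x : H} {y : D.domain}
    (hy : (y : H) = oneAddSqInvSqrt D x) : boundedTransform D x = D y := by
  obtain ⟨y', hy', h⟩ := boundedTransform_spec hD x
  rw [h, Subtype.ext (hy'.trans hy.symm)]

/-- `F` commutes with `R² = (1 + D²)⁻¹`, hence with its positive square root `R`. -/
theorem commute_boundedTransform (hD : IsSelfAdjoint D) :
    Commute (boundedTransform D) (oneAddSqInvSqrt D) := by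
  suffices h : Commute (oneAddSqInv D) (boundedTransform D) from (h.cfcₙ_nnreal _).symm
  ext x
  obtain ⟨y, hy, h⟩ := boundedTransform_spec hD x
  obtain ⟨a, ha, h'⟩ := oneAddSqInv_apply_map hD y
  rw [mul_apply_eq_comp, mul_apply_eq_comp, h, h', boundedTransform_apply hD]
  rw [ha, hy, ← oneAddSqInvSqrt_mul_self hD]
  rfl

/-- `F* R = R F = F R` by the symmetry of `D` on its domain, and `R` has dense range. -/
theorem isSelfAdjoint_boundedTransform (hD : IsSelfAdjoint D) :
    IsSelfAdjoint (boundedTransform D) := by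
  have hRs := (IsSelfAdjoint.of_nonneg (oneAddSqInvSqrt_nonneg (D := D))).star_eq
  have h : star (boundedTransform D) * oneAddSqInvSqrt D =
      boundedTransform D * oneAddSqInvSqrt D := by
    rw [(commute_boundedTransform hD).eq]
    ext x
    refine ext_inner_right ℂ fun z => ?_
    obtain ⟨y, hy, h⟩ := boundedTransform_spec hD x
    obtain ⟨w, hw, h'⟩ := boundedTransform_spec hD z
    rw [mul_apply_eq_comp, mul_apply_eq_comp, inner_oneAddSqInvSqrt,
      ContinuousLinearMap.star_eq_adjoint, ContinuousLinearMap.adjoint_inner_left, h', h, ← hy,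
      ← hw, inner_apply_symm hD]
  exact sub_eq_zero.1 (eq_zero_of_mul_oneAddSqInvSqrt hD (by rw [sub_mul, h, sub_self]))

theorem boundedTransform_sq_add (hD : IsSelfAdjoint D) :
    boundedTransform D * boundedTransform D + oneAddSqInvSqrt D * oneAddSqInvSqrt D = 1 := by
  ext x
  obtain ⟨a, c, ha, hc, hx⟩ := oneAddSqInv_spec hD x
  rw [← oneAddSqInvSqrt_mul_self hD] at ha
  have h1 : (c : H) = oneAddSqInvSqrt D (boundedTransform D x) := by
    rw [hc, ← boundedTransform_apply hD ha]
    exact congrArg (fun T : H →L[ℂ] H => T x) (commute_boundedTransform hD).eq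
  rw [add_apply, mul_apply_eq_comp, ← ha, boundedTransform_apply hD h1, add_comm, hx]
  rfl

/-- `R D ⊆ F`. -/
theorem oneAddSqInvSqrt_apply_map (hD : IsSelfAdjoint D) (y : D.domain) :
    oneAddSqInvSqrt D (D y) = boundedTransform D y := by
  refine ext_inner_right ℂ fun x => ?_
  obtain ⟨w, hw, h⟩ := boundedTransform_spec hD x
  have hs := (isSelfAdjoint_boundedTransform hD).isSymmetric y x
  rw [inner_oneAddSqInvSqrt, ← hw, inner_apply_symm hD, ← h]
  exact hs.symm

theorem boundedTransform_commutator (hD : IsSelfAdjoint D) {T C : H →L[ℂ] H}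
    (h : IsCommutator D T C) :
    boundedTransform D * T * oneAddSqInvSqrt D - oneAddSqInvSqrt D * T * boundedTransform D =
      oneAddSqInvSqrt D * C * oneAddSqInvSqrt D := by
  ext x
  obtain ⟨y, hy, hFx⟩ := boundedTransform_spec hD x
  obtain ⟨w, hw, hC⟩ := h y
  simp only [sub_apply, mul_apply_eq_comp]
  rw [← hy, hC, map_sub, oneAddSqInvSqrt_apply_map hD, hw, hFx]

/-- The grading commutes with `(1 + D²)⁻¹` since that operator is determined by its equation, hence
with `R`. -/
theorem boundedTransform_odd (hD : IsSelfAdjoint D) {ε : H →L[ℂ] H}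
    (hodd : ∀ x : D.domain, ∃ y : D.domain, (y : H) = ε x ∧ D y = -ε (D x)) :
    boundedTransform D * ε = -(ε * boundedTransform D) := by
  have hS : Commute (oneAddSqInv D) ε := by
    ext x
    obtain ⟨a, c, ha, hc, hx⟩ := oneAddSqInv_spec hD x
    obtain ⟨a', ha', hDa⟩ := hodd a
    obtain ⟨c', hc', hDc⟩ := hodd c
    rw [mul_apply_eq_comp, mul_apply_eq_comp, ← ha, ← ha']
    refine oneAddSqInv_apply_eq hD a' (-c') ?_ ?_
    · rw [Submodule.coe_neg, hc', hc, hDa]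
    · rw [LinearPMap.map_neg, hDc, ha', neg_neg, ← map_add, hx]
  have hR : Commute (oneAddSqInvSqrt D) ε := hS.cfcₙ_nnreal _
  ext x
  obtain ⟨y, hy, h⟩ := boundedTransform_spec hD x
  obtain ⟨y', hy', h'⟩ := hodd y
  rw [neg_apply, mul_apply_eq_comp, mul_apply_eq_comp, h, ← h']
  refine boundedTransform_apply hD ?_
  rw [hy', hy]
  exact congrArg (fun T : H →L[ℂ] H => T x) hR.eq.symm

end BoundedTransform
end LCKasparov

/-! ### The Kasparov module -/

namespace LCKasparov

section Descent

variable {X Y B C : Type*} [TopologicalSpace X] [TopologicalSpace Y] [TopologicalSpace B]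

theorem IsContinuousInto.of_comp {ι : B → C} (hι : Function.Injective ι) {f : X → Y}
    (hf : Topology.IsQuotientMap f) {g : Y → C} (h : IsContinuousInto ι fun x => g (f x)) :
    IsContinuousInto ι g := by
  obtain ⟨u, hu, hug⟩ := h
  refine ⟨fun y => u (Function.surjInv hf.surjective y), ?_, fun y => ?_⟩
  · refine hf.continuous_iff.2 ?_
    convert! hu using 1
    ext x
    refine hι ?_
    exact (hug _).trans ((congrArg g (Function.surjInv_eq hf.surjective _)).trans (hug x).symm)
  · exact (hug _).trans (congrArg g (Function.surjInv_eq hf.surjective y))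

end Descent

/-- The factorization of the commutators of `F = D (1 + D²)^(-1/2)`: `K` has the order of
`(1 + D²)^(-1/4)`. -/
theorem exists_boundedTransform_commutator_factorization {H : Type*} [NormedAddCommGroup H]
    [InnerProductSpace ℂ H] [CompleteSpace H] {D : H →ₗ.[ℂ] H} (hD : IsSelfAdjoint D) :
    ∃ (K J Q : H →L[ℂ] H) (Λ₁ Λ₂ : (H →L[ℂ] H) → H →L[ℂ] H), Continuous Λ₁ ∧ Continuous Λ₂ ∧
      IsSelfAdjoint K ∧ K * K = oneAddSqInvSqrt D * J ∧ K * K = J * oneAddSqInvSqrt D ∧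
      1 - boundedTransform D * boundedTransform D = K * Q ∧
      1 - boundedTransform D * boundedTransform D = Q * K ∧
      ∀ T C, IsCommutator D T C →
        T * boundedTransform D - boundedTransform D * T = K * Λ₁ C ∧
        T * boundedTransform D - boundedTransform D * T = Λ₂ C * K := by
  obtain ⟨K, J, Q, Λ₁, Λ₂, h₁, h₂, hK, hKJ, hJK, hQ, hQ', h⟩ :=
    exists_commutator_factorization (R := oneAddSqInvSqrt D) (F := boundedTransform D)
      oneAddSqInvSqrt_nonneg (isSelfAdjoint_boundedTransform hD) (commute_boundedTransform hD)
      (boundedTransform_sq_add hD) fun E => eq_zero_of_mul_oneAddSqInvSqrt hD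
  have hRR : 1 - boundedTransform D * boundedTransform D =
      oneAddSqInvSqrt D * oneAddSqInvSqrt D := by
    rw [← boundedTransform_sq_add hD, add_sub_cancel_left]
  exact ⟨K, J, Q, Λ₁, Λ₂, h₁, h₂, hK, hKJ, hJK, hRR.trans hQ, hRR.trans hQ',
    fun T C hT => h T C (boundedTransform_commutator hD hT)⟩

section Representation

variable {A : Type*} [NonUnitalRing A] [StarRing A] [Module ℂ A] [TopologicalSpace A]
  {H : Type*} [NormedAddCommGroup H] [InnerProductSpace ℂ H] [CompleteSpace H]
  {p : ℝ} {φ : A →⋆ₙₐ[ℂ] (H →L[ℂ] H)} {R J K : H →L[ℂ] H}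

/-- If `φ(a) R` is in `L^p` and `K² = R J`, then `φ(a) K` is in `L^(2p)`, as
`(φ(a) K) (φ(a) K)* = φ(a) R J φ(a)*`. -/
theorem isContinuousInto_rep_mul (hp : 1 ≤ p) (hφ : Continuous φ)
    (h : IsContinuousInto (SchattenClass.incl H p hp) fun a => φ a * R) (hK : IsSelfAdjoint K)
    (hKR : K * K = R * J) :
    IsContinuousInto (SchattenClass.incl H (2 * p) (one_le_two_mul hp)) fun a => φ a * K := by
  refine isContinuousInto_two_mul hp
    (g := (AddMonoidHom.mulRight K).comp (φ : A →+ (H →L[ℂ] H)))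
    (y := (AddMonoidHom.mulRight R).comp (φ : A →+ (H →L[ℂ] H)))
    (z := (AddMonoidHom.mulLeft J).comp ((starAddEquiv : (H →L[ℂ] H) ≃+ _).toAddMonoidHom.comp
      (φ : A →+ (H →L[ℂ] H))))
    h (continuous_const.mul hφ.star) fun a n => ?_
  change singularNumber (φ a * K) n ^ 2 ≤ ‖J * star (φ a)‖ * singularNumber (φ a * R) n
  refine (singularNumber_sq_le_mul_star_self _ n).trans ?_
  have : φ a * K * star (φ a * K) = φ a * R * (J * star (φ a)) := by
    rw [star_mul, hK.star_eq]
    linear_combination (norm := noncomm_ring) φ a * hKR * star (φ a)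
  rw [this, mul_comm ‖_‖]
  exact singularNumber_mul_le_right _ _ n

theorem isContinuousInto_mul_rep (hp : 1 ≤ p) (hφ : Continuous φ)
    (h : IsContinuousInto (SchattenClass.incl H p hp) fun a => R * φ a) (hK : IsSelfAdjoint K)
    (hKR : K * K = J * R) :
    IsContinuousInto (SchattenClass.incl H (2 * p) (one_le_two_mul hp)) fun a => K * φ a := by
  refine isContinuousInto_two_mul hp
    (g := (AddMonoidHom.mulLeft K).comp (φ : A →+ (H →L[ℂ] H)))
    (y := (AddMonoidHom.mulLeft R).comp (φ : A →+ (H →L[ℂ] H)))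
    (z := (AddMonoidHom.mulRight J).comp ((starAddEquiv : (H →L[ℂ] H) ≃+ _).toAddMonoidHom.comp
      (φ : A →+ (H →L[ℂ] H))))
    h (hφ.star.mul continuous_const) fun a n => ?_
  change singularNumber (K * φ a) n ^ 2 ≤ ‖star (φ a) * J‖ * singularNumber (R * φ a) n
  refine (singularNumber_sq_le_star_mul_self _ n).trans ?_
  have : star (K * φ a) * (K * φ a) = star (φ a) * J * (R * φ a) := by
    rw [star_mul, hK.star_eq]
    linear_combination (norm := noncomm_ring) star (φ a) * hKR * φ a
  rw [this]
  exact singularNumber_mul_le_left _ _ n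

/-- If all commutators `[φ(a), F]` factor through `K` on either side, then for products
`[φ(b c), F] = φ(b) [φ(c), F] + [φ(b), F] φ(c)` is a combination of terms containing `φ(b) K` or
`K φ(c)`. As the multiplication is a quotient map, this is enough. -/
theorem isContinuousInto_commutator [ContinuousMul A]
    (hsurj : Function.Surjective fun x : A × A => x.1 * x.2)
    (hopen : IsOpenMap fun x : A × A => x.1 * x.2) {q : ℝ} {hq : 1 ≤ q} {F : H →L[ℂ] H}
    (hφK : IsContinuousInto (SchattenClass.incl H q hq) fun a => φ a * K)
    (hKφ : IsContinuousInto (SchattenClass.incl H q hq) fun a => K * φ a)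
    {X₁ X₂ : A → H →L[ℂ] H} (hX₁ : Continuous X₁) (hX₂ : Continuous X₂)
    (h₁ : ∀ a, φ a * F - F * φ a = K * X₁ a) (h₂ : ∀ a, φ a * F - F * φ a = X₂ a * K) :
    IsContinuousInto (SchattenClass.incl H q hq) fun a => φ a * F - F * φ a := by
  refine IsContinuousInto.of_comp SchattenClass.incl_injective
    (hopen.isQuotientMap continuous_mul hsurj) ?_
  have h1 := (hφK.comp (continuous_fst (X := A) (Y := A))).mul_right (hX₁.comp continuous_snd)
  have h2 := (hKφ.comp (continuous_snd (X := A) (Y := A))).mul_left (hX₂.comp continuous_fst)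
  have h3 : (fun x : A × A => φ (x.1 * x.2) * F - F * φ (x.1 * x.2)) =
      fun x => φ x.1 * K * X₁ x.2 + X₂ x.1 * (K * φ x.2) := by
    funext x
    rw [map_mul]
    linear_combination (norm := noncomm_ring) φ x.1 * h₁ x.2 + h₂ x.1 * φ x.2
  rw [h3]
  exact h1.add h2

end Representation

end LCKasparov

theorem mainTheorem3 {A : Type*} [NonUnitalRing A] [StarRing A] [Module ℂ A] [StarModule ℂ A]
    [UniformSpace A] [LCKasparov.LocallyConvexAlgebra A]
    (hsurj : Function.Surjective fun x : A × A => x.1 * x.2)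
    (hopen : IsOpenMap fun x : A × A => x.1 * x.2)
    {H : Type*} [NormedAddCommGroup H] [InnerProductSpace ℂ H] [CompleteSpace H]
    (p : ℝ) (hp : 1 ≤ p) (φ : A →⋆ₙₐ[ℂ] (H →L[ℂ] H)) (D : H →ₗ.[ℂ] H) (ε : H →L[ℂ] H)
    (hD : LCKasparov.IsContinuousSummableSpectralTriple p hp φ D)
    (hε : LCKasparov.IsEvenFor ε φ D) :
    LCKasparov.IsLCKasparovModule
      (LCKasparov.SchattenClass.incl H (2 * p) (LCKasparov.one_le_two_mul hp))
      φ.toNonUnitalAlgHom ε (LCKasparov.boundedTransform D) := by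
  open LCKasparov in
  have hDs := hD.selfAdjoint
  have hφ := hD.continuous_rep
  obtain ⟨δ, hδ, hcomm⟩ := hD.continuous_commutator
  have hid : IsContinuousInto (SchattenClass.incl H (2 * p) (one_le_two_mul hp))
      (SchattenClass.incl H (2 * p) (one_le_two_mul hp)) := ⟨id, continuous_id, fun _ => rfl⟩
  obtain ⟨K, J, Q, Λ₁, Λ₂, hΛ₁, hΛ₂, hK, hKR, hKR', hQ, hQ', hΛ⟩ :=
    exists_boundedTransform_commutator_factorization hDs
  have hδΛ := fun a => hΛ _ _ (hcomm a)
  have hφK := isContinuousInto_rep_mul hp hφ hD.summable_right hK hKR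
  have hKφ := isContinuousInto_mul_rep hp hφ hD.summable_left hK hKR'
  have hleft : ∀ X : H →L[ℂ] H, IsContinuousInto (SchattenClass.incl H (2 * p) (one_le_two_mul hp))
      fun b => X * SchattenClass.incl H (2 * p) (one_le_two_mul hp) b := fun X =>
    IsContinuousInto.mul_left (f := fun _ => X) continuous_const hid
  have hright : ∀ X : H →L[ℂ] H, IsContinuousInto (SchattenClass.incl H (2 * p) (one_le_two_mul hp))
      fun b => SchattenClass.incl H (2 * p) (one_le_two_mul hp) b * X := fun X =>
    IsContinuousInto.mul_right (f := fun _ => X) hid continuous_const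
  exact {
    locallyConvexAlgebra_left := inferInstance
    locallyConvexAlgebra_right := SchattenClass.locallyConvexAlgebra hp
    injective := SchattenClass.incl_injective
    grading_sq := hε.sq
    odd := boundedTransform_odd hDs hε.odd
    even := hε.even
    mul_F := hright _
    F_mul := hleft _
    grading_mul := hleft ε
    mul_grading := hright ε
    rep_mul := (hid.comp continuous_snd).mul_left (hφ.comp continuous_fst)
    mul_rep := (hid.comp continuous_snd).mul_right (hφ.comp continuous_fst)
    rep_mul_one_sub_sq := by
      have := IsContinuousInto.mul_right (f := fun _ => Q) hφK continuous_const
      simp only [mul_assoc, ← hQ] at this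
      exact this
    one_sub_sq_mul_rep := by
      have := IsContinuousInto.mul_left (f := fun _ => Q) continuous_const hKφ
      simp only [← mul_assoc, ← hQ'] at this
      exact this
    commutator := isContinuousInto_commutator hsurj hopen hφK hKφ (hΛ₁.comp hδ) (hΛ₂.comp hδ)
      (fun a => (hδΛ a).1) fun a => (hδΛ a).2 }
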